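/- **Theorem (Agreement theorem).** For a set $S$ write $\binom{S}{\le d}$ for the family of subsets of $S$ of size at most $d$, and $\binom{S}{k}$ for the family of subsets of size exactly $k$. There is a constant $C>1$ such that for every positive integer $d$ and all $\alpha,\beta\in(0,1)$ with $\alpha+\beta\le 1$ there is a constant $K=K(\alpha,\beta,d)>0$ for which the following holds. Let $n,k,t$ be positive integers with $n\ge Ck$, $t\ge\max\{\alpha k,d\}$ and $k-t\ge\max\{\beta k,d\}$, let $\Sigma$ be any alphabet, and let $\{f_S\colon\binom{S}{\le d}\to\Sigma \mid S\in\binom{[n]}{k}\}$ be an ensemble of local functions such that $$\Pr_{S_1,S_2}\left[f_{S_1}|_{S_1\cap S_2}\ne f_{S_2}|_{S_1\cap S_2}\right]\le\epsilon ,$$ where $(S_1,S_2)$ is uniformly distributed over the pairs in $\binom{[n]}{k}\times\binom{[n]}{k}$ with $|S_1\cap S_2|=t$. Then there is a function $F\colon\binom{[n]}{\le d}\to\Sigma$ such that $$\Pr_{S}\left[f_S\ne F|_S\right]\le K\,\epsilon ,$$ where $S$ is uniformly distributed over $\binom{[n]}{k}$. Here $f|_S$ denotes the restriction of $f$ to $\binom{S}{\le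 d}$. -/

import Mathlib

/-- The `k`-element subsets of the `n`-element ground set `Fin n`. -/
abbrev KSubset (n k : ℕ) : Type := {S : Finset (Fin n) // S.card = k}

/-- The subsets of `S` that have at most `d` elements. -/
abbrev SmallSubset {n : ℕ} (d : ℕ) (S : Finset (Fin n)) : Type :=
  {A : Finset (Fin n) // A ⊆ S ∧ A.card ≤ d}

/-- An ensemble of local functions: for every `k`-subset `S`, a function on the subsets of `S` of
size at most `d`, with values in the alphabet. -/
abbrev LocalEnsemble (n k d : ℕ) (Alphabet : Type*) : Type _ :=
  (S : KSubset n k) → SmallSubset d S.1 → Alphabet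

/-- A global function: a function on all subsets of the ground set of size at most `d`. -/
abbrev GlobalFunction (n d : ℕ) (Alphabet : Type*) : Type _ :=
  SmallSubset d (Finset.univ : Finset (Fin n)) → Alphabet

/-- The restriction `f|_S`, for `S ⊆ S'`, of a function `f` on the subsets of `S'` of size at most
`d` to the subsets of `S` of size at most `d`. -/
def restrictTo {n d : ℕ} {Alphabet : Type*} {S S' : Finset (Fin n)} (h : S ⊆ S')
    (f : SmallSubset d S' → Alphabet) : SmallSubset d S → Alphabet :=
  fun A => f ⟨A.1, A.2.1.trans h, A.2.2⟩

open Classical in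
/-- The probability of the event `P` under the uniform distribution on the finite set `s`. -/
noncomputable def uniformProb {Ω : Type*} (s : Finset Ω) (P : Ω → Prop) : ℝ :=
  ((s.filter P).card : ℝ) / (s.card : ℝ)

/-- The pairs of `k`-subsets of `Fin n` whose intersection has exactly `t` elements. -/
def pairsWithInter (n k t : ℕ) : Finset (KSubset n k × KSubset n k) :=
  Finset.univ.filter fun p => (p.1.1 ∩ p.2.1).card = t

/-- The probability that `f_{S₁}` and `f_{S₂}` differ on `S₁ ∩ S₂`, for a uniformly random pair of
`k`-subsets with `|S₁ ∩ S₂| = t`. -/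
noncomputable def disagreementProb {n k d : ℕ} {Alphabet : Type*} (t : ℕ)
    (f : LocalEnsemble n k d Alphabet) : ℝ :=
  uniformProb (pairsWithInter n k t) fun p =>
    restrictTo (Finset.inter_subset_left : p.1.1 ∩ p.2.1 ⊆ p.1.1) (f p.1) ≠
      restrictTo (Finset.inter_subset_right : p.1.1 ∩ p.2.1 ⊆ p.2.1) (f p.2)

/-- The probability that `f_S ≠ F|_S`, for a uniformly random `k`-subset `S`. -/
noncomputable def globalErrorProb {n k d : ℕ} {Alphabet : Type*}
    (f : LocalEnsemble n k d Alphabet) (F : GlobalFunction n d Alphabet) : ℝ :=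
  uniformProb (Finset.univ : Finset (KSubset n k)) fun S =>
    f S ≠ restrictTo (Finset.subset_univ S.1) F

open Finset
open scoped BigOperators

set_option linter.unusedSectionVars false

section Averages

variable {V : Type*} [Fintype V] [DecidableEq V]

/-- The sets `U` of size `u` with `W ⊆ U ⊆ S`. -/
def between (W S : Finset V) (u : ℕ) : Finset (Finset V) :=
  (S.powersetCard u).filter (W ⊆ ·)

/-- The sets of size `k` that contain `W`. -/
abbrev supersets (W : Finset V) (k : ℕ) : Finset (Finset V) := between W univ k

/-- The permutations that fix every point of `W`. -/
def fixers (W : Finset V) : Finset (Equiv.Perm V) :=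
  univ.filter fun π => ∀ x ∈ W, π x = x

/-- The image of a set under a permutation. -/
def moved (π : Equiv.Perm V) (S : Finset V) : Finset V := S.map π.toEmbedding

open Classical in
/-- The indicator of a proposition. -/
noncomputable def ind (P : Prop) : ℝ := if P then 1 else 0

theorem mem_between {W S U : Finset V} {u : ℕ} :
    U ∈ between W S u ↔ U ⊆ S ∧ U.card = u ∧ W ⊆ U := by
  simp [between, mem_powersetCard, and_assoc]

theorem mem_supersets {W U : Finset V} {u : ℕ} :
    U ∈ supersets W u ↔ U.card = u ∧ W ⊆ U := by
  simp [mem_between]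

theorem mem_fixers {W : Finset V} {π : Equiv.Perm V} :
    π ∈ fixers W ↔ ∀ x ∈ W, π x = x := by
  simp [fixers]

theorem one_mem_fixers (W : Finset V) : 1 ∈ fixers W := by simp [mem_fixers]

theorem fixers_nonempty (W : Finset V) : (fixers W).Nonempty := ⟨1, one_mem_fixers W⟩

theorem mul_mem_fixers_iff {W : Finset V} {π σ : Equiv.Perm V} (hσ : σ ∈ fixers W) :
    π ∈ fixers W ↔ π * σ ∈ fixers W := by
  simp only [mem_fixers] at *
  refine forall₂_congr fun x hx => ?_
  simp [hσ x hx]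

theorem ind_true {P : Prop} (h : P) : ind P = 1 := by simp [ind, h]

theorem ind_false {P : Prop} (h : ¬ P) : ind P = 0 := by simp [ind, h]

theorem ind_nonneg (P : Prop) : 0 ≤ ind P := by
  unfold ind; split_ifs <;> norm_num

theorem ind_le_one (P : Prop) : ind P ≤ 1 := by
  unfold ind; split_ifs <;> norm_num

theorem ind_mono {P Q : Prop} (h : P → Q) : ind P ≤ ind Q := by
  by_cases hP : P
  · rw [ind_true hP, ind_true (h hP)]
  · rw [ind_false hP]; exact ind_nonneg _

theorem ind_le_add {P Q R : Prop} (h : P → Q ∨ R) : ind P ≤ ind Q + ind R := by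
  by_cases hP : P
  · rw [ind_true hP]
    rcases h hP with h | h
    · rw [ind_true h]; linarith [ind_nonneg R]
    · rw [ind_true h]; linarith [ind_nonneg Q]
  · rw [ind_false hP]; linarith [ind_nonneg R, ind_nonneg Q]

theorem ind_and (P Q : Prop) : ind (P ∧ Q) = ind P * ind Q := by
  by_cases hP : P <;> by_cases hQ : Q <;> simp [ind, hP, hQ]

theorem ind_congr {P Q : Prop} (h : P ↔ Q) : ind P = ind Q := by rw [propext h]

theorem card_moved (π : Equiv.Perm V) (S : Finset V) : (moved π S).card = S.card := by
  simp [moved]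

theorem moved_subset_moved {π : Equiv.Perm V} {S T : Finset V} :
    moved π S ⊆ moved π T ↔ S ⊆ T := by
  simp [moved]

theorem moved_mul (π σ : Equiv.Perm V) (S : Finset V) :
    moved (π * σ) S = moved π (moved σ S) := by
  simp only [moved, map_map]; rfl

theorem moved_inter (π : Equiv.Perm V) (S T : Finset V) :
    moved π (S ∩ T) = moved π S ∩ moved π T := by
  simp [moved, map_inter]

theorem moved_eq_self {W : Finset V} {π : Equiv.Perm V} (h : π ∈ fixers W) : moved π W = W := by
  rw [mem_fixers] at h
  apply eq_of_subset_of_card_le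
  · intro x hx
    simp only [moved, mem_map, Equiv.coe_toEmbedding] at hx
    obtain ⟨y, hy, rfl⟩ := hx
    rwa [h y hy]
  · rw [card_moved]

theorem moved_bijective (π : Equiv.Perm V) : Function.Bijective (moved π) := by
  have : moved π = π.finsetCongr := by ext; simp [moved]
  rw [this]; exact Equiv.bijective _

theorem expect_between_moved (π : Equiv.Perm V) (W S : Finset V) (u : ℕ) (g : Finset V → ℝ) :
    𝔼 U ∈ between W S u, g (moved π U) = 𝔼 U ∈ between (moved π W) (moved π S) u, g U := by
  refine expect_equiv (Equiv.ofBijective _ (moved_bijective π)) (fun U => ?_) fun U _ => rfl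
  simp [mem_between, card_moved, moved_subset_moved]

theorem moved_univ (π : Equiv.Perm V) : moved π (univ : Finset V) = univ := by
  simp [moved]

theorem expect_supersets_moved (π : Equiv.Perm V) (W : Finset V) (u : ℕ) (g : Finset V → ℝ) :
    𝔼 U ∈ supersets W u, g (moved π U) = 𝔼 U ∈ supersets (moved π W) u, g U := by
  rw [expect_between_moved, moved_univ]

theorem expect_fixers_mul {W : Finset V} {σ : Equiv.Perm V} (hσ : σ ∈ fixers W)
    (g : Equiv.Perm V → ℝ) : 𝔼 π ∈ fixers W, g (π * σ) = 𝔼 π ∈ fixers W, g π :=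
  expect_equiv (Equiv.mulRight σ) (fun _ => mul_mem_fixers_iff hσ) fun _ _ => rfl

/-- The permutations fixing `W` act transitively on the pairs of sets containing `W` with
prescribed sizes of the sets and of their intersection. -/
theorem exists_fixer_moved_eq {W A B A' B' : Finset V} (hA : W ⊆ A) (hB : W ⊆ B) (hA' : W ⊆ A')
    (hB' : W ⊆ B') (h1 : A.card = A'.card) (h2 : B.card = B'.card)
    (h3 : (A ∩ B).card = (A' ∩ B').card) :
    ∃ σ ∈ fixers W, moved σ A = A' ∧ moved σ B = B' := by
  let c : Finset V → Finset V → V → Option V × Prop × Prop :=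
    fun A B x => (if x ∈ W then some x else none, x ∈ A, x ∈ B)
  have key : ∀ γ, Nonempty ({x // c A B x = γ} ≃ {x // c A' B' x = γ}) := by
    classical
    rintro ⟨o, a, b⟩
    rw [← Fintype.card_eq, Fintype.card_subtype, Fintype.card_subtype]
    simp only [c, Prod.mk.injEq]
    cases o with
    | some y =>
      congr 1
      ext x
      simp only [mem_filter, mem_univ, true_and]
      by_cases hx : x ∈ W
      · simp [hx, hA hx, hB hx, hA' hx, hB' hx]
      · simp [hx]
    | none =>
      have e : ∀ A B : Finset V, (univ.filter fun x => (if x ∈ W then some x else none) = none ∧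
          (x ∈ A) = a ∧ (x ∈ B) = b) = univ.filter fun x => x ∉ W ∧ (x ∈ A ↔ a) ∧ (x ∈ B ↔ b) := by
        intro A B; ext x; by_cases hx : x ∈ W <;> simp [hx]
      rw [e, e]
      by_cases ha : a <;> by_cases hb : b <;> simp only [ha, hb, iff_true, iff_false]
      · have e : ∀ A B : Finset V, W ⊆ A → W ⊆ B → (univ.filter fun x => x ∉ W ∧ x ∈ A ∧ x ∈ B)
            = (A ∩ B) \ W := by
          intro A B _ _; ext x; simp; tauto
        rw [e A B hA hB, e A' B' hA' hB', card_sdiff_of_subset (subset_inter hA hB),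
          card_sdiff_of_subset (subset_inter hA' hB'), h3]
      · have e : ∀ A B : Finset V, W ⊆ B → (univ.filter fun x => x ∉ W ∧ x ∈ A ∧ x ∉ B)
            = A \ B := by
          intro A B h; ext x; simp; intro _ h2 h3; exact h2 (h h3)
        rw [e A B hB, e A' B' hB']
        have := card_sdiff_add_card_inter A B
        have := card_sdiff_add_card_inter A' B'
        omega
      · have e : ∀ A B : Finset V, W ⊆ A → (univ.filter fun x => x ∉ W ∧ x ∉ A ∧ x ∈ B)
            = B \ A := by
          intro A B h; ext x
          simp only [mem_filter, mem_univ, true_and, mem_sdiff]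
          have := @h x
          tauto
        rw [e A B hA, e A' B' hA']
        have := card_sdiff_add_card_inter B A
        have := card_sdiff_add_card_inter B' A'
        rw [inter_comm] at h3
        rw [inter_comm A' B'] at h3
        omega
      · have e : ∀ A B : Finset V, W ⊆ A → (univ.filter fun x => x ∉ W ∧ x ∉ A ∧ x ∉ B)
            = (A ∪ B)ᶜ := by
          intro A B h; ext x
          simp only [mem_filter, mem_univ, true_and, mem_compl, mem_union]
          have := @h x
          tauto
        rw [e A B hA, e A' B' hA', card_compl, card_compl]
        have := card_union_add_card_inter A B
        have := card_union_add_card_inter A' B'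
        have : (A ∪ B).card = (A' ∪ B').card := by omega
        rw [this]
  let e := fun γ => Classical.choice (key γ)
  let σ : Equiv.Perm V := Equiv.ofFiberEquiv e
  have hσ : ∀ x, c A' B' (σ x) = c A B x := fun x => Equiv.ofFiberEquiv_map e x
  simp only [c, Prod.mk.injEq] at hσ
  refine ⟨σ, mem_fixers.2 fun x hx => ?_, ?_, ?_⟩
  · have := (hσ x).1
    rw [if_pos hx] at this
    split_ifs at this
    exact Option.some.inj this
  · apply eq_of_subset_of_card_le
    · intro x hx
      simp only [moved, mem_map, Equiv.coe_toEmbedding] at hx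
      obtain ⟨y, hy, rfl⟩ := hx
      rw [(hσ y).2.1]; exact hy
    · rw [card_moved, h1]
  · apply eq_of_subset_of_card_le
    · intro x hx
      simp only [moved, mem_map, Equiv.coe_toEmbedding] at hx
      obtain ⟨y, hy, rfl⟩ := hx
      rw [(hσ y).2.2]; exact hy
    · rw [card_moved, h2]

/-- The average of a function over the orbit of a pair of sets depends only on the sizes. -/
theorem expect_fixers_pair_eq {W A B A' B' : Finset V} (hA : W ⊆ A) (hB : W ⊆ B) (hA' : W ⊆ A')
    (hB' : W ⊆ B') (h1 : A.card = A'.card) (h2 : B.card = B'.card)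
    (h3 : (A ∩ B).card = (A' ∩ B').card) (φ : Finset V → Finset V → ℝ) :
    𝔼 π ∈ fixers W, φ (moved π A) (moved π B) = 𝔼 π ∈ fixers W, φ (moved π A') (moved π B') := by
  obtain ⟨σ, hσ, rfl, rfl⟩ := exists_fixer_moved_eq hA hB hA' hB' h1 h2 h3
  rw [← expect_fixers_mul hσ fun π => φ (moved π A) (moved π B)]
  simp only [moved_mul]

theorem between_nonempty {W S : Finset V} {u : ℕ} (hWS : W ⊆ S) (h1 : W.card ≤ u)
    (h2 : u ≤ S.card) : (between W S u).Nonempty := by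
  obtain ⟨U, hU⟩ := exists_subsuperset_card_eq hWS h1 h2
  exact ⟨U, mem_between.2 ⟨hU.2.1, hU.2.2, hU.1⟩⟩

theorem supersets_nonempty {W : Finset V} {u : ℕ} (h1 : W.card ≤ u)
    (h2 : u ≤ Fintype.card V) : (supersets W u).Nonempty :=
  between_nonempty (subset_univ _) h1 (by simpa using h2)

/-- The average over the orbit of a flag, choosing the larger set first. -/
theorem expect_fixers_flag {W A B : Finset V} (hA : W ⊆ A) (hB : A ⊆ B)
    (φ : Finset V → Finset V → ℝ) :
    𝔼 π ∈ fixers W, φ (moved π A) (moved π B) =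
      𝔼 S ∈ supersets W B.card, 𝔼 U ∈ between W S A.card, φ U S := by
  have hinv : ∀ π ∈ fixers W, 𝔼 S ∈ supersets W B.card, 𝔼 U ∈ between W S A.card,
      φ (moved π U) (moved π S) = 𝔼 S ∈ supersets W B.card, 𝔼 U ∈ between W S A.card, φ U S := by
    intro π hπ
    have := expect_supersets_moved π W B.card fun S => 𝔼 U ∈ between W S A.card, φ U S
    rw [moved_eq_self hπ] at this
    rw [← this]
    refine expect_congr rfl fun S _ => ?_
    have := expect_between_moved π W S A.card fun U => φ U (moved π S)
    rwa [moved_eq_self hπ] at this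
  rw [← expect_const (fixers_nonempty W)
    (𝔼 S ∈ supersets W B.card, 𝔼 U ∈ between W S A.card, φ U S), ← expect_congr rfl hinv,
    expect_comm]
  rw [← expect_const (supersets_nonempty (card_le_card (hA.trans hB)) (card_le_univ B))
    (𝔼 π ∈ fixers W, φ (moved π A) (moved π B))]
  refine expect_congr rfl fun S hS => ?_
  rw [mem_supersets] at hS
  rw [expect_comm]
  rw [← expect_const (between_nonempty hS.2 (card_le_card hA) (hS.1 ▸ card_le_card hB))
    (𝔼 π ∈ fixers W, φ (moved π A) (moved π B))]
  refine expect_congr rfl fun U hU => ?_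
  rw [mem_between] at hU
  refine expect_fixers_pair_eq hA (hA.trans hB) hU.2.2 hS.2 hU.2.1.symm hS.1.symm ?_ _
  rw [inter_eq_left.2 hB, inter_eq_left.2 hU.1, hU.2.1]

/-- The average over the orbit of a flag, choosing the smaller set first. -/
theorem expect_fixers_flag' {W A B : Finset V} (hA : W ⊆ A) (hB : A ⊆ B)
    (φ : Finset V → Finset V → ℝ) :
    𝔼 π ∈ fixers W, φ (moved π A) (moved π B) =
      𝔼 U ∈ supersets W A.card, 𝔼 S ∈ supersets U B.card, φ U S := by
  have hinv : ∀ π ∈ fixers W, 𝔼 U ∈ supersets W A.card, 𝔼 S ∈ supersets U B.card,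
      φ (moved π U) (moved π S) = 𝔼 U ∈ supersets W A.card, 𝔼 S ∈ supersets U B.card, φ U S := by
    intro π hπ
    have := expect_supersets_moved π W A.card fun U => 𝔼 S ∈ supersets U B.card, φ U S
    rw [moved_eq_self hπ] at this
    rw [← this]
    refine expect_congr rfl fun U _ => ?_
    exact expect_supersets_moved π U B.card fun S => φ (moved π U) S
  rw [← expect_const (fixers_nonempty W)
    (𝔼 U ∈ supersets W A.card, 𝔼 S ∈ supersets U B.card, φ U S), ← expect_congr rfl hinv,
    expect_comm]
  rw [← expect_const (supersets_nonempty (card_le_card hA) (card_le_univ A))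
    (𝔼 π ∈ fixers W, φ (moved π A) (moved π B))]
  refine expect_congr rfl fun U hU => ?_
  rw [mem_supersets] at hU
  rw [expect_comm]
  rw [← expect_const (supersets_nonempty (hU.1 ▸ card_le_card hB) (card_le_univ B))
    (𝔼 π ∈ fixers W, φ (moved π A) (moved π B))]
  refine expect_congr rfl fun S hS => ?_
  rw [mem_supersets] at hS
  refine expect_fixers_pair_eq hA (hA.trans hB) hU.2 (hU.2.trans hS.2) hU.1.symm hS.1.symm ?_ _
  rw [inter_eq_left.2 hB, inter_eq_left.2 hS.2, hU.1]

theorem expect_fixers_single {W A : Finset V} (hA : W ⊆ A) (φ : Finset V → ℝ) :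
    𝔼 π ∈ fixers W, φ (moved π A) = 𝔼 U ∈ supersets W A.card, φ U := by
  rw [expect_fixers_flag' hA (Subset.refl A) fun U _ => φ U]
  refine expect_congr rfl fun U hU => ?_
  rw [mem_supersets] at hU
  exact expect_const (supersets_nonempty hU.1.le (card_le_univ A)) _

/-- A uniform flag `W ⊆ U ⊆ S` can be chosen in either order. -/
theorem expect_supersets_comm {W : Finset V} {u s : ℕ} (h1 : W.card ≤ u) (h2 : u ≤ s)
    (h3 : s ≤ Fintype.card V) (φ : Finset V → Finset V → ℝ) :
    𝔼 S ∈ supersets W s, 𝔼 U ∈ between W S u, φ U S =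
      𝔼 U ∈ supersets W u, 𝔼 S ∈ supersets U s, φ U S := by
  obtain ⟨A, hA⟩ := supersets_nonempty h1 (h2.trans h3)
  rw [mem_supersets] at hA
  obtain ⟨B, hB⟩ := supersets_nonempty (hA.1.le.trans h2) h3
  rw [mem_supersets] at hB
  have := expect_fixers_flag hA.2 hB.2 φ
  rw [expect_fixers_flag' hA.2 hB.2, hA.1, hB.1] at this
  exact this.symm

/-- If `E` is a property of `s`-sets and `E'` a property of `v`-sets with `2 * v ≤ s`, then the
probability of `E` is at most the square of that of `E'`, up to the probability that a random
subset of a set in `E` fails to be in `E'`. -/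
theorem expect_le_sq_add {W : Finset V} {v s : ℕ} (h1 : W.card ≤ v) (h2 : 2 * v ≤ s)
    (h3 : s ≤ Fintype.card V) (E E' : Finset V → Prop) :
    𝔼 S ∈ supersets W s, ind (E S) ≤ (𝔼 U ∈ supersets W v, ind (E' U)) ^ 2 +
      2 * 𝔼 S ∈ supersets W s, 𝔼 U ∈ between W S v, ind (E S ∧ ¬ E' U) := by
  have hne : (supersets W v).Nonempty := supersets_nonempty h1 (by omega)
  have key : ∀ U₁ ∈ supersets W v, ∀ U₂ ∈ supersets W v, 𝔼 S ∈ supersets W s, ind (E S) ≤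
      𝔼 π ∈ fixers W, ind (E' (moved π U₁)) * ind (E' (moved π U₂)) +
      2 * 𝔼 S ∈ supersets W s, 𝔼 U ∈ between W S v, ind (E S ∧ ¬ E' U) := by
    intro U₁ hU₁ U₂ hU₂
    rw [mem_supersets] at hU₁ hU₂
    have hcard : (U₁ ∪ U₂).card ≤ s := (card_union_le _ _).trans (by omega)
    obtain ⟨S, hS⟩ := supersets_nonempty hcard h3
    rw [mem_supersets] at hS
    have hS1 : U₁ ⊆ S := subset_union_left.trans hS.2
    have hS2 : U₂ ⊆ S := subset_union_right.trans hS.2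
    have e1 := expect_fixers_flag hU₁.2 hS1 fun U S => ind (E S ∧ ¬ E' U)
    have e2 := expect_fixers_flag hU₂.2 hS2 fun U S => ind (E S ∧ ¬ E' U)
    have e0 := expect_fixers_single (hU₁.2.trans hS1) fun S => ind (E S)
    rw [hU₁.1, hS.1] at e1
    rw [hU₂.1, hS.1] at e2
    rw [hS.1] at e0
    rw [← e0, two_mul]
    nth_rw 1 [← e1]
    rw [← e2, ← expect_add_distrib, ← expect_add_distrib]
    refine expect_le_expect fun π _ => ?_
    rw [← ind_and]
    refine (ind_le_add (R := (E (moved π S) ∧ ¬ E' (moved π U₁)) ∨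
      (E (moved π S) ∧ ¬ E' (moved π U₂))) (Q := E' (moved π U₁) ∧ E' (moved π U₂))
        (by tauto)).trans ?_
    gcongr
    exact ind_le_add id
  have : 𝔼 S ∈ supersets W s, ind (E S) ≤ 𝔼 U₁ ∈ supersets W v, 𝔼 U₂ ∈ supersets W v,
      (𝔼 π ∈ fixers W, ind (E' (moved π U₁)) * ind (E' (moved π U₂)) +
      2 * 𝔼 S ∈ supersets W s, 𝔼 U ∈ between W S v, ind (E S ∧ ¬ E' U)) :=
    le_expect hne fun U₁ hU₁ => le_expect hne fun U₂ hU₂ => key U₁ hU₁ U₂ hU₂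
  refine this.trans (le_of_eq ?_)
  simp only [expect_add_distrib, expect_const hne]
  congr 1
  have : ∀ U₁ ∈ supersets W v, 𝔼 U₂ ∈ supersets W v, 𝔼 π ∈ fixers W,
      ind (E' (moved π U₁)) * ind (E' (moved π U₂)) =
      𝔼 π ∈ fixers W, ind (E' (moved π U₁)) * 𝔼 U ∈ supersets W v, ind (E' U) := by
    intro U₁ _
    rw [expect_comm]
    refine expect_congr rfl fun π hπ => ?_
    rw [← mul_expect, expect_supersets_moved π W v fun U => ind (E' U), moved_eq_self hπ]
  rw [expect_congr rfl this, expect_comm]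
  have : ∀ π ∈ fixers W, 𝔼 U₁ ∈ supersets W v,
      ind (E' (moved π U₁)) * 𝔼 U ∈ supersets W v, ind (E' U) =
      (𝔼 U ∈ supersets W v, ind (E' U)) ^ 2 := by
    intro π hπ
    rw [← expect_mul, expect_supersets_moved π W v fun U => ind (E' U), moved_eq_self hπ, sq]
  rw [expect_congr rfl this, expect_const (fixers_nonempty W)]

end Averages

section Counting

theorem cast_choose_succ_mul {s u j : ℕ} (hj : j < u) (hu : u ≤ s) :
    ((s - (j + 1)).choose (u - (j + 1)) : ℝ) * ((s : ℝ) - j) =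
      ((s - j).choose (u - j) : ℝ) * ((u : ℝ) - j) := by
  obtain ⟨a, rfl⟩ : ∃ a, u = a + 1 + j := ⟨u - j - 1, by omega⟩
  obtain ⟨b, rfl⟩ : ∃ b, s = b + 1 + j := ⟨s - j - 1, by omega⟩
  have e1 : b + 1 + j - (j + 1) = b := by omega
  have e2 : a + 1 + j - (j + 1) = a := by omega
  have e3 : b + 1 + j - j = b + 1 := by omega
  have e4 : a + 1 + j - j = a + 1 := by omega
  rw [e1, e2, e3, e4]
  have := Nat.add_one_mul_choose_eq b a
  have : ((b + 1 : ℕ) : ℝ) * (b.choose a : ℝ) = ((b + 1).choose (a + 1) : ℝ) * ((a + 1 : ℕ) : ℝ) := by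
    exact_mod_cast this
  push_cast at this ⊢
  linarith

/-- The chance that `a` given points lie in a random `u`-subset of an `s`-set is at least `r ^ a`
if `u` is large enough compared to `r * s`. -/
theorem pow_mul_choose_le {r : ℝ} (hr : 0 ≤ r) {s u : ℕ} (hu : u ≤ s) :
    ∀ a : ℕ, a ≤ u → r * s ≤ (u : ℝ) - a + 1 →
      r ^ a * (s.choose u : ℝ) ≤ ((s - a).choose (u - a) : ℝ)
  | 0, _, _ => by simp
  | a + 1, ha, h => by
    have ih := pow_mul_choose_le hr hu a (by omega) (by push_cast at h; linarith)
    have e := cast_choose_succ_mul (show a < u by omega) hu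
    have hsa : (0 : ℝ) < (s : ℝ) - a := by
      have : ((a : ℝ) + 1) ≤ s := by exact_mod_cast (ha.trans hu)
      linarith
    refine le_of_mul_le_mul_right ?_ hsa
    rw [e]
    push_cast at h
    have h0 : (0 : ℝ) ≤ a := Nat.cast_nonneg a
    calc r ^ (a + 1) * (s.choose u : ℝ) * ((s : ℝ) - a)
        = (r ^ a * (s.choose u : ℝ)) * (r * ((s : ℝ) - a)) := by ring
      _ ≤ ((s - a).choose (u - a) : ℝ) * ((u : ℝ) - a) := by
          apply mul_le_mul ih _ (mul_nonneg hr hsa.le) (by positivity)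
          nlinarith

theorem choose_log_concave {s u x y : ℕ} (hu : u ≤ s) :
    ∀ z, x + y + z ≤ u →
      ((s - (x + y + z)).choose (u - (x + y + z)) : ℝ) * ((s - x).choose (u - x) : ℝ) ≤
      ((s - (x + y)).choose (u - (x + y)) : ℝ) * ((s - (x + z)).choose (u - (x + z)) : ℝ)
  | 0, _ => by simp
  | z + 1, h => by
    have ih := choose_log_concave (x := x) (y := y) hu z (by omega)
    have e1 := cast_choose_succ_mul (show x + y + z < u by omega) hu
    have e2 := cast_choose_succ_mul (show x + z < u by omega) hu
    have hs : ((x + y + z + 1 : ℕ) : ℝ) ≤ s := by exact_mod_cast (by omega)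
    have hus : (u : ℝ) ≤ s := by exact_mod_cast hu
    have hu' : ((x + y + z + 1 : ℕ) : ℝ) ≤ u := by exact_mod_cast (by omega)
    have hx : (0 : ℝ) ≤ x := Nat.cast_nonneg x
    have hy : (0 : ℝ) ≤ y := Nat.cast_nonneg y
    have hz : (0 : ℝ) ≤ z := Nat.cast_nonneg z
    push_cast at e1 e2 hs hu'
    have p1 : (0 : ℝ) < s - (x + y + z) := by linarith
    have p2 : (0 : ℝ) < s - (x + z) := by linarith
    rw [← add_assoc, ← add_assoc]
    set c1 : ℝ := ((s - (x + y + z + 1)).choose (u - (x + y + z + 1)) : ℝ)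
    set c2 : ℝ := ((s - (x + z + 1)).choose (u - (x + z + 1)) : ℝ)
    rw [← eq_div_iff p1.ne'] at e1
    rw [← eq_div_iff p2.ne'] at e2
    rw [e1, e2, div_mul_eq_mul_div, mul_div_assoc', div_le_div_iff₀ p1 p2]
    set C0 : ℝ := ((s - (x + y + z)).choose (u - (x + y + z)) : ℝ)
    set C1 : ℝ := ((s - x).choose (u - x) : ℝ)
    set C2 : ℝ := ((s - (x + y)).choose (u - (x + y)) : ℝ)
    set C3 : ℝ := ((s - (x + z)).choose (u - (x + z)) : ℝ)
    have q : ((u : ℝ) - (x + y + z)) * (s - (x + z)) ≤ (u - (x + z)) * (s - (x + y + z)) := by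
      nlinarith
    calc C0 * ((u : ℝ) - (x + y + z)) * C1 * (s - (x + z))
        = (C0 * C1) * (((u : ℝ) - (x + y + z)) * (s - (x + z))) := by ring
      _ ≤ (C2 * C3) * ((u - (x + z)) * (s - (x + y + z))) := by
          apply mul_le_mul ih q (mul_nonneg (by linarith) p2.le) (by positivity)
      _ = _ := by ring

end Counting

section Between

variable {V : Type*} [Fintype V] [DecidableEq V]

theorem card_between {W S : Finset V} {u : ℕ} (hWS : W ⊆ S) (h : W.card ≤ u) :
    (between W S u).card = (S.card - W.card).choose (u - W.card) := by
  rw [← card_sdiff_of_subset hWS, ← card_powersetCard]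
  refine card_nbij' (· \ W) (· ∪ W) ?_ ?_ ?_ ?_
  · intro U hU
    rw [mem_coe, mem_between] at hU
    rw [mem_coe, mem_powersetCard, card_sdiff_of_subset hU.2.2, hU.2.1]
    exact ⟨sdiff_subset_sdiff hU.1 (Subset.refl _), rfl⟩
  · intro U hU
    rw [mem_coe, mem_powersetCard] at hU
    rw [mem_coe, mem_between]
    refine ⟨union_subset (hU.1.trans sdiff_subset) hWS, ?_, subset_union_right⟩
    rw [card_union_of_disjoint (disjoint_of_subset_left hU.1 sdiff_disjoint), hU.2]
    omega
  · intro U hU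
    rw [mem_coe, mem_between] at hU
    exact sdiff_union_of_subset hU.2.2
  · intro U hU
    rw [mem_coe, mem_powersetCard] at hU
    exact union_sdiff_cancel_right (disjoint_of_subset_left hU.1 sdiff_disjoint)

theorem between_subset_between {W e : Finset V} (h : W ⊆ e) (S : Finset V) (u : ℕ) :
    between e S u ⊆ between W S u := by
  intro U hU
  rw [mem_between] at *
  exact ⟨hU.1, hU.2.1, h.trans hU.2.2⟩

theorem filter_between {W e : Finset V} (h : W ⊆ e) (S : Finset V) (u : ℕ) :
    (between W S u).filter (e ⊆ ·) = between e S u := by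
  ext U
  simp only [mem_filter, mem_between]
  constructor
  · tauto
  · rintro ⟨h1, h2, h3⟩
    exact ⟨⟨h1, h2, h.trans h3⟩, h3⟩

theorem sum_between_ind_mul {W e : Finset V} (h : W ⊆ e) (S : Finset V) (u : ℕ)
    (g : Finset V → ℝ) :
    ∑ U ∈ between W S u, ind (e ⊆ U) * g U = ∑ U ∈ between e S u, g U := by
  rw [← filter_between h, sum_filter]
  refine sum_congr rfl fun U _ => ?_
  by_cases hU : e ⊆ U <;> simp [ind, hU]

theorem expect_between_ind {W e : Finset V} (h : W ⊆ e) (S : Finset V) (u : ℕ) :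
    𝔼 U ∈ between W S u, ind (e ⊆ U) = ((between e S u).card : ℝ) / (between W S u).card := by
  have := sum_between_ind_mul h S u fun _ => 1
  rw [expect_eq_sum_div_card]
  simp only [mul_one, sum_const, nsmul_eq_mul] at this
  rw [this]

theorem card_between_pos {W S : Finset V} {u : ℕ} (hWS : W ⊆ S) (h1 : W.card ≤ u)
    (h2 : u ≤ S.card) : (0 : ℝ) < (between W S u).card := by
  exact_mod_cast (between_nonempty hWS h1 h2).card_pos

theorem pow_mul_card_between_le {r : ℝ} (hr : 0 ≤ r) (hr1 : r ≤ 1) {d u : ℕ} {W e S : Finset V}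
    (hWe : W ⊆ e) (heS : e ⊆ S) (hd : e.card ≤ W.card + d) (heu : e.card ≤ u) (hu : u ≤ S.card)
    (h : r * S.card ≤ (u : ℝ) - e.card + 1) :
    r ^ d * ((between W S u).card : ℝ) ≤ (between e S u).card := by
  have hc := card_le_card hWe
  rw [card_between (hWe.trans heS) (hc.trans heu), card_between heS heu]
  have hWS := card_le_card (hWe.trans heS)
  have key := pow_mul_choose_le hr (show u - W.card ≤ S.card - W.card by omega)
    (e.card - W.card) (by omega) (by
      rw [Nat.cast_sub hc, Nat.cast_sub hWS, Nat.cast_sub (hc.trans heu)]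
      have : (0 : ℝ) ≤ W.card := Nat.cast_nonneg _
      nlinarith)
  have e1 : S.card - W.card - (e.card - W.card) = S.card - e.card := by omega
  have e2 : u - W.card - (e.card - W.card) = u - e.card := by omega
  rw [e1, e2] at key
  refine le_trans ?_ key
  gcongr ?_ * _
  exact pow_le_pow_of_le_one hr hr1 (by omega)

/-- Conditioning a random subset on containing a few more points increases averages at most by a
constant factor. -/
theorem pow_mul_expect_between_le {r : ℝ} (hr : 0 ≤ r) (hr1 : r ≤ 1) {d u : ℕ} {W e S : Finset V}
    (hWe : W ⊆ e) (heS : e ⊆ S) (hd : e.card ≤ W.card + d) (heu : e.card ≤ u) (hu : u ≤ S.card)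
    (h : r * S.card ≤ (u : ℝ) - e.card + 1) (g : Finset V → ℝ) (hg : ∀ U, 0 ≤ g U) :
    r ^ d * 𝔼 U ∈ between e S u, g U ≤ 𝔼 U ∈ between W S u, g U := by
  have key := pow_mul_card_between_le hr hr1 hWe heS hd heu hu h
  have p1 := card_between_pos heS heu hu
  have p2 := card_between_pos (hWe.trans heS) ((card_le_card hWe).trans heu) hu
  rw [expect_eq_sum_div_card, expect_eq_sum_div_card, mul_div_assoc', div_le_div_iff₀ p1 p2]
  have hsum : ∑ U ∈ between e S u, g U ≤ ∑ U ∈ between W S u, g U :=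
    sum_le_sum_of_subset_of_nonneg (between_subset_between hWe S u) fun U _ _ => hg U
  have h0 : 0 ≤ ∑ U ∈ between e S u, g U := sum_nonneg fun U _ => hg U
  calc r ^ d * (∑ U ∈ between e S u, g U) * (between W S u).card
      = (∑ U ∈ between e S u, g U) * (r ^ d * (between W S u).card) := by ring
    _ ≤ (∑ U ∈ between W S u, g U) * (between e S u).card := by
        apply mul_le_mul hsum key (by positivity) (h0.trans hsum)

theorem card_between_log_concave {S e₁ e₂ : Finset V} {u : ℕ} (h1 : e₁ ⊆ S) (h2 : e₂ ⊆ S)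
    (hu : u ≤ S.card) :
    ((between (e₁ ∪ e₂) S u).card : ℝ) * (between (e₁ ∩ e₂) S u).card ≤
      (between e₁ S u).card * (between e₂ S u).card := by
  by_cases h : (e₁ ∪ e₂).card ≤ u
  · have c1 := card_le_card (subset_union_left (s₁ := e₁) (s₂ := e₂))
    have c2 := card_le_card (subset_union_right (s₁ := e₁) (s₂ := e₂))
    have c3 := card_le_card (inter_subset_left (s₁ := e₁) (s₂ := e₂))
    have c4 := card_le_card (inter_subset_right (s₁ := e₁) (s₂ := e₂))
    have c5 := card_union_add_card_inter e₁ e₂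
    rw [card_between (union_subset h1 h2) h, card_between (inter_subset_left.trans h1) (by omega),
      card_between h1 (by omega), card_between h2 (by omega)]
    have := choose_log_concave (x := (e₁ ∩ e₂).card) (y := e₁.card - (e₁ ∩ e₂).card) hu
      (e₂.card - (e₁ ∩ e₂).card) (by omega)
    have q1 : (e₁ ∩ e₂).card + (e₁.card - (e₁ ∩ e₂).card) + (e₂.card - (e₁ ∩ e₂).card) =
      (e₁ ∪ e₂).card := by omega
    have q2 : (e₁ ∩ e₂).card + (e₁.card - (e₁ ∩ e₂).card) = e₁.card := by omega
    have q3 : (e₁ ∩ e₂).card + (e₂.card - (e₁ ∩ e₂).card) = e₂.card := by omega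
    rwa [q1, q2, q3] at this
  · have : between (e₁ ∪ e₂) S u = ∅ := by
      rw [eq_empty_iff_forall_notMem]
      intro U hU
      rw [mem_between] at hU
      exact h (hU.2.1 ▸ card_le_card hU.2.2)
    rw [this]
    simp only [card_empty, Nat.cast_zero, zero_mul]
    positivity

/-- Double counting of the pairs `e ⊆ S`. -/
theorem expect_sum_between {W : Finset V} {j s : ℕ} (h1 : W.card ≤ j) (h2 : j ≤ s)
    (h3 : s ≤ Fintype.card V) (g : Finset V → Finset V → ℝ) :
    𝔼 S ∈ supersets W s, ∑ e ∈ between W S j, g e S =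
      ((s - W.card).choose (j - W.card) : ℝ) * 𝔼 e ∈ supersets W j, 𝔼 S ∈ supersets e s, g e S := by
  rw [← expect_supersets_comm h1 h2 h3, mul_expect]
  refine expect_congr rfl fun S hS => ?_
  rw [mem_supersets] at hS
  rw [← card_mul_expect, card_between hS.2 h1, hS.1]

/-- A sunflower with many petals keeps many petals when restricted to a random subset. -/
theorem expect_few_petals_le {e U : Finset V} {v : ℕ} (heU : e ⊆ U) (hev : e.card ≤ v)
    (hv : v ≤ U.card) {P : Finset (Finset V)} (hP : ∀ A ∈ P, e ⊆ A ∧ A ⊆ U)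
    (hP' : ∀ A ∈ P, ∀ A' ∈ P, A ≠ A' → A ∩ A' = e) {ρ : ℝ}
    (hρ : ∀ A ∈ P, ρ * ((between e U v).card : ℝ) ≤ (between A U v).card) {N : ℕ}
    (h1 : 2 * (N : ℝ) ≤ ρ * P.card) (h2 : 32 ≤ ρ * P.card) :
    𝔼 U' ∈ between e U v, ind ((P.filter (· ⊆ U')).card < N) ≤ 1 / 8 := by
  have hc := card_between_pos heU hev hv
  set c : ℝ := ((between e U v).card : ℝ)
  let p : Finset V → ℝ := fun A => 𝔼 U' ∈ between e U v, ind (A ⊆ U')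
  have hp : ∀ A ∈ P, p A = (between A U v).card / c := fun A hA =>
    expect_between_ind (hP A hA).1 U v
  set μ : ℝ := ∑ A ∈ P, p A with hμdef
  have hμ : ρ * P.card ≤ μ := by
    calc ρ * P.card = ∑ A ∈ P, ρ := by simp [mul_comm]
      _ ≤ μ := sum_le_sum fun A hA => by
        rw [hp A hA, le_div_iff₀ hc]; exact hρ A hA
  have hμ0 : 0 < μ := by linarith
  let Z : Finset V → ℝ := fun U' => ∑ A ∈ P, ind (A ⊆ U')
  have hZ : ∀ U', Z U' = ((P.filter (· ⊆ U')).card : ℝ) := by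
    intro U'
    simp only [Z, ind, card_filter]
    push_cast
    refine sum_congr rfl fun A _ => ?_
    split_ifs <;> rfl
  have hEZ : 𝔼 U' ∈ between e U v, Z U' = μ := by
    simp only [Z, hμdef, p]
    rw [expect_sum_comm]
  have hEZ2 : 𝔼 U' ∈ between e U v, Z U' ^ 2 ≤ μ + μ ^ 2 := by
    have : ∀ U', Z U' ^ 2 = ∑ A ∈ P, ∑ A' ∈ P, ind (A ∪ A' ⊆ U') := by
      intro U'
      simp only [Z]
      rw [sq, sum_mul_sum]
      refine sum_congr rfl fun A _ => sum_congr rfl fun A' _ => ?_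
      rw [← ind_and, union_subset_iff]
    simp only [this]
    rw [expect_sum_comm]
    have : ∀ A ∈ P, 𝔼 U' ∈ between e U v, ∑ A' ∈ P, ind (A ∪ A' ⊆ U') ≤ p A + p A * μ := by
      intro A hA
      rw [expect_sum_comm, hμdef, mul_sum, ← sum_erase_add _ _ hA, union_self, add_comm]
      refine add_le_add le_rfl ?_
      refine le_trans ?_ (sum_le_sum_of_subset_of_nonneg (erase_subset A P) fun A' hA' _ => ?_)
      · refine sum_le_sum fun A' hA' => ?_
        rw [mem_erase] at hA'
        have hAA' := hP A' hA'.2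
        rw [expect_between_ind ((hP A hA).1.trans subset_union_left), hp A hA, hp A' hA'.2,
          div_mul_div_comm, div_le_div_iff₀ hc (by positivity)]
        have := card_between_log_concave (hP A hA).2 hAA'.2 hv
        rw [hP' A hA A' hA'.2 hA'.1.symm] at this
        calc ((between (A ∪ A') U v).card : ℝ) * (c * c)
            = ((between (A ∪ A') U v).card * c) * c := by ring
          _ ≤ _ := by gcongr
      · rw [hp A hA, hp A' hA']; positivity
    refine (sum_le_sum this).trans (le_of_eq ?_)
    rw [sum_add_distrib, ← sum_mul, sq]
  have hpt : ∀ U' ∈ between e U v, ind ((P.filter (· ⊆ U')).card < N) ≤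
      4 / μ ^ 2 * (Z U' ^ 2 - 2 * μ * Z U' + μ ^ 2) := by
    intro U' _
    by_cases h : (P.filter (· ⊆ U')).card < N
    · rw [ind_true h, div_mul_eq_mul_div, le_div_iff₀ (by positivity), hZ]
      have h' : ((P.filter (· ⊆ U')).card : ℝ) ≤ N := by exact_mod_cast h.le
      set z : ℝ := ((P.filter (· ⊆ U')).card : ℝ)
      have : z ≤ μ / 2 := by linarith
      nlinarith
    · rw [ind_false h]
      have : Z U' ^ 2 - 2 * μ * Z U' + μ ^ 2 = (Z U' - μ) ^ 2 := by ring
      rw [this]; positivity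
  refine (expect_le_expect hpt).trans ?_
  rw [← mul_expect, expect_add_distrib, expect_sub_distrib, ← mul_expect, hEZ,
    expect_const (between_nonempty heU hev hv)]
  calc 4 / μ ^ 2 * (𝔼 U' ∈ between e U v, Z U' ^ 2 - 2 * μ * μ + μ ^ 2) ≤ 4 / μ ^ 2 * μ := by
        gcongr
        nlinarith
    _ = 4 / μ := by field_simp
    _ ≤ 1 / 8 := by rw [div_le_div_iff₀ hμ0 (by norm_num)]; linarith

end Between

section Rich

variable {V : Type*} [Fintype V] [DecidableEq V]

/-- The set `e` is `N`-rich in the family `M` if it is a member of `M`, or the core of a sunflower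
with at least `N` petals that are members of `M`. -/
def Rich (N : ℕ) (M : Finset (Finset V)) (e : Finset V) : Prop :=
  e ∈ M ∨ ∃ P ⊆ M, N ≤ P.card ∧ (∀ A ∈ P, e ⊆ A) ∧ ∀ A ∈ P, ∀ A' ∈ P, A ≠ A' → A ∩ A' = e

/-- The set `e ⊇ W` is an `(N, N')`-kernel of `M` if it is `N`-rich and no proper subset of `e`
containing `W` is `N'`-rich. -/
def IsKernel (W : Finset V) (N N' : ℕ) (M : Finset (Finset V)) (e : Finset V) : Prop :=
  W ⊆ e ∧ Rich N M e ∧ ∀ e', W ⊆ e' → e' ⊂ e → ¬ Rich N' M e'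

theorem Rich.mono {N : ℕ} {M M' : Finset (Finset V)} {e : Finset V} (h : Rich N M e)
    (hM : M ⊆ M') : Rich N M' e := by
  rcases h with h | ⟨P, hP, h⟩
  · exact Or.inl (hM h)
  · exact Or.inr ⟨P, hP.trans hM, h⟩

theorem Rich.anti {N N' : ℕ} {M : Finset (Finset V)} {e : Finset V} (h : Rich N M e)
    (hN : N' ≤ N) : Rich N' M e := by
  rcases h with h | ⟨P, hP, h1, h2⟩
  · exact Or.inl h
  · exact Or.inr ⟨P, hP, hN.trans h1, h2⟩

theorem Rich.exists_superset {N : ℕ} {M : Finset (Finset V)} {e : Finset V} (h : Rich N M e)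
    (hN : 0 < N) : ∃ A ∈ M, e ⊆ A := by
  rcases h with h | ⟨P, hP, h1, h2, -⟩
  · exact ⟨e, h, Subset.refl e⟩
  · obtain ⟨A, hA⟩ := card_pos.1 (hN.trans_le h1)
    exact ⟨A, hP hA, h2 A hA⟩

theorem exists_isKernel {W : Finset V} (a : ℕ → ℕ) {M : Finset (Finset V)} :
    ∀ (r : ℕ) (e : Finset V), W ⊆ e → e.card ≤ W.card + r → Rich (a (r + 1)) M e →
      ∃ r' ≤ r, ∃ e', IsKernel W (a (r' + 1)) (a r') M e'
  | 0, e, hWe, hc, he => by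
    have : e = W := (eq_of_subset_of_card_le hWe (by simpa using hc)).symm
    subst this
    exact ⟨0, le_rfl, e, hWe, he, fun e' h1 h2 => absurd h1 (not_subset_of_ssubset h2)⟩
  | r + 1, e, hWe, hc, he => by
    by_cases h : ∀ e', W ⊆ e' → e' ⊂ e → ¬ Rich (a (r + 1)) M e'
    · exact ⟨r + 1, le_rfl, e, hWe, he, h⟩
    · push Not at h
      obtain ⟨e', h1, h2, h3⟩ := h
      have := card_lt_card h2
      obtain ⟨r', hr', h'⟩ := exists_isKernel a r e' h1 (by omega) h3
      exact ⟨r', by omega, h'⟩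

theorem exists_cover_of_not_rich {N d : ℕ} {M : Finset (Finset V)} (hM : ∀ A ∈ M, A.card ≤ d)
    {g : Finset V} (hg : ¬ Rich N M g) :
    ∃ C : Finset V, C.card ≤ d * N ∧ (∀ x ∈ C, x ∉ g) ∧ ∀ A ∈ M, g ⊆ A → ∃ x ∈ A, x ∈ C := by
  classical
  simp only [Rich, not_or, not_exists, not_and] at hg
  obtain ⟨hgM, hg⟩ := hg
  let Q : Finset (Finset V) → Prop := fun P =>
    (∀ A ∈ P, g ⊆ A) ∧ ∀ A ∈ P, ∀ A' ∈ P, A ≠ A' → A ∩ A' = g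
  obtain ⟨P, hP, hmax⟩ := exists_max_image (M.powerset.filter Q) card
    ⟨∅, by simp [Q]⟩
  rw [mem_filter, mem_powerset] at hP
  obtain ⟨hPM, hP1, hP2⟩ := hP
  have hPN : P.card < N := by
    by_contra h
    exact hg P hPM (not_lt.1 h) hP1 hP2
  refine ⟨P.biUnion id \ g, ?_, fun x hx => (mem_sdiff.1 hx).2, ?_⟩
  · calc (P.biUnion id \ g).card ≤ (P.biUnion id).card := card_le_card sdiff_subset
      _ ≤ P.card * d := card_biUnion_le_card_mul _ _ _ fun A hA => hM A (hPM hA)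
      _ ≤ d * N := by rw [mul_comm]; gcongr
  · intro A hA hgA
    by_contra hcon
    push Not at hcon
    have hout : ∀ A' ∈ P, ∀ x ∈ A, x ∈ A' → x ∈ g := by
      intro A' hA' x hx hx'
      by_contra hxg
      exact hcon x hx (mem_sdiff.2 ⟨mem_biUnion.2 ⟨A', hA', hx'⟩, hxg⟩)
    have hAP : A ∉ P := by
      intro hAP
      have : A ⊆ g := fun x hx => hout A hAP x hx hx
      exact hgM (Subset.antisymm hgA this ▸ hA)
    have hins : insert A P ∈ M.powerset.filter Q := by
      rw [mem_filter, mem_powerset]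
      refine ⟨insert_subset hA hPM, ?_, ?_⟩
      · intro B hB
        rcases mem_insert.1 hB with rfl | hB
        · exact hgA
        · exact hP1 B hB
      · intro B hB B' hB' hne
        rcases mem_insert.1 hB with rfl | hb <;> rcases mem_insert.1 hB' with rfl | hb'
        · exact absurd rfl hne
        · refine Subset.antisymm (fun x hx => ?_) (subset_inter hgA (hP1 _ hb'))
          rw [mem_inter] at hx
          exact hout B' hb' x hx.1 hx.2
        · refine Subset.antisymm (fun x hx => ?_) (subset_inter (hP1 _ hb) hgA)
          rw [mem_inter] at hx
          exact hout B hb x hx.2 hx.1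
        · exact hP2 B hb B' hb' hne
    have := hmax _ hins
    rw [card_insert_of_notMem hAP] at this
    omega

/-- A bound for the number of kernels that contain a set of size at least `d - l`. -/
def kernelBound (d N : ℕ) : ℕ → ℕ
  | 0 => 1
  | l + 1 => 1 + d * N * kernelBound d N l

theorem kernelBound_pos (d N l : ℕ) : 0 < kernelBound d N l := by
  cases l <;> simp [kernelBound]

theorem card_filter_isKernel_le {W : Finset V} {N d : ℕ} {M : Finset (Finset V)}
    (hM : ∀ A ∈ M, A.card ≤ d) {T : Finset (Finset V)}
    (hT : ∀ e ∈ T, IsKernel W (d * N + 1) N M e) :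
    ∀ (l : ℕ) (g : Finset V), W ⊆ g → d ≤ g.card + l →
      (T.filter (g ⊆ ·)).card ≤ kernelBound d N l := by
  have hcard : ∀ e ∈ T, e.card ≤ d := by
    intro e he
    obtain ⟨A, hA, heA⟩ := (hT e he).2.1.exists_superset (Nat.succ_pos _)
    exact (card_le_card heA).trans (hM A hA)
  intro l
  induction l with
  | zero =>
    intro g _ hd
    refine card_le_one.2 fun e he e' he' => ?_
    rw [mem_filter] at he he'
    have h1 := eq_of_subset_of_card_le he.2 ((hcard e he.1).trans hd)
    have h2 := eq_of_subset_of_card_le he'.2 ((hcard e' he'.1).trans hd)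
    rw [← h1, ← h2]
  | succ l ih =>
    intro g hWg hd
    by_cases hg : Rich N M g
    · have : T.filter (g ⊆ ·) ⊆ {g} := by
        intro e he
        rw [mem_filter] at he
        rw [mem_singleton]
        by_contra hne
        exact (hT e he.1).2.2 g hWg (he.2.ssubset_of_ne (Ne.symm hne)) hg
      refine (card_le_card this).trans ?_
      rw [card_singleton]
      exact kernelBound_pos _ _ _
    · obtain ⟨C, hC1, hC2, hC3⟩ := exists_cover_of_not_rich hM hg
      have hsub : T.filter (g ⊆ ·) ⊆
          {g} ∪ C.biUnion fun x => T.filter (insert x g ⊆ ·) := by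
        intro e he
        rw [mem_filter] at he
        rw [mem_union, mem_singleton, mem_biUnion]
        refine or_iff_not_imp_left.2 fun _ => ?_
        suffices h : ∃ x ∈ e, x ∈ C by
          obtain ⟨x, hxe, hxC⟩ := h
          exact ⟨x, hxC, mem_filter.2 ⟨he.1, insert_subset hxe he.2⟩⟩
        rcases (hT e he.1).2.1 with heM | ⟨P, hPM, hP1, hP2, hP3⟩
        · exact hC3 e heM he.2
        · by_contra hcon
          push Not at hcon
          have hx : ∀ A ∈ P, ∃ x ∈ A, x ∈ C := fun A hA => hC3 A (hPM hA) (he.2.trans (hP2 A hA))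
          obtain ⟨A₀, hA₀⟩ : P.Nonempty := card_pos.1 (by omega)
          have : Nonempty V := (hx A₀ hA₀).nonempty
          choose! x hx1 hx2 using hx
          have hle : P.card ≤ C.card := by
            refine card_le_card_of_injOn x (fun A hA => hx2 A hA) fun A hA A' hA' hxx => ?_
            by_contra hne
            have : x A ∈ A ∩ A' := mem_inter.2 ⟨hx1 A hA, hxx ▸ hx1 A' hA'⟩
            rw [hP3 A hA A' hA' hne] at this
            exact hcon _ this (hx2 A hA)
          omega
      calc (T.filter (g ⊆ ·)).card ≤ _ := card_le_card hsub
        _ ≤ 1 + C.card * kernelBound d N l := by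
          refine (card_union_le _ _).trans ?_
          rw [card_singleton]
          gcongr
          refine card_biUnion_le_card_mul _ _ _ fun x hx => ih _ ?_ ?_
          · exact hWg.trans (subset_insert _ _)
          · rw [card_insert_of_notMem (hC2 x hx)]; omega
        _ ≤ kernelBound d N (l + 1) := by
          simp only [kernelBound]
          gcongr

theorem sum_ind_eq_card_filter {ι : Type*} (s : Finset ι) (p : ι → Prop) [DecidablePred p] :
    ∑ i ∈ s, ind (p i) = ((s.filter p).card : ℝ) := by
  rw [card_filter]
  push_cast
  refine sum_congr rfl fun i _ => ?_
  by_cases h : p i <;> simp [ind, h]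

theorem sum_ind_isKernel_le {W : Finset V} {N d : ℕ} {M : Finset (Finset V)}
    (hM : ∀ A ∈ M, A.card ≤ d) (s : Finset (Finset V)) :
    ∑ e ∈ s, ind (IsKernel W (d * N + 1) N M e) ≤ kernelBound d N d := by
  classical
  rw [sum_ind_eq_card_filter]
  norm_cast
  have := card_filter_isKernel_le (W := W) hM
    (T := s.filter (IsKernel W (d * N + 1) N M)) (fun e he => (mem_filter.1 he).2) d W
    (Subset.refl _) (by omega)
  rwa [filter_true_of_mem fun e he => (mem_filter.1 he).2.1] at this

/-- A kernel of a family on `U` remains a kernel, with a smaller parameter, of the restriction of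
the family to a random subset of `U`. -/
theorem expect_not_isKernel_le {W e U : Finset V} {v d N N₁ N' : ℕ} {M : Finset (Finset V)}
    (hM : ∀ A ∈ M, A ⊆ U ∧ A.card ≤ d) (hN : 0 < N) (he : IsKernel W N N' M e)
    (hv : v ≤ U.card) (hd : d ≤ v) (hvU : (1 / 4 : ℝ) * U.card ≤ (v : ℝ) - d + 1)
    (h1 : 2 * (N₁ : ℝ) ≤ (1 / 4) ^ d * N) (h2 : (32 : ℝ) ≤ (1 / 4) ^ d * N) :
    𝔼 U' ∈ between e U v, ind (¬ IsKernel W N₁ N' (M.filter (· ⊆ U')) e) ≤ 1 / 8 := by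
  obtain ⟨A₀, hA₀, heA₀⟩ := he.2.1.exists_superset hN
  have heU : e ⊆ U := heA₀.trans (hM A₀ hA₀).1
  have hev : e.card ≤ v := (card_le_card heA₀).trans ((hM A₀ hA₀).2.trans hd)
  have hred : ∀ U' ∈ between e U v, ¬ IsKernel W N₁ N' (M.filter (· ⊆ U')) e →
      ¬ Rich N₁ (M.filter (· ⊆ U')) e := by
    intro U' _ h hr
    exact h ⟨he.1, hr, fun e' h1 h2 h3 => he.2.2 e' h1 h2 (h3.mono (filter_subset _ _))⟩
  rcases he.2.1 with heM | ⟨P, hPM, hP1, hP2, hP3⟩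
  · refine le_trans (expect_le_expect (g := fun _ => 0) fun U' hU' => ?_) (by simp)
    rw [ind_false]
    exact fun h => hred U' hU' h (Or.inl (mem_filter.2 ⟨heM, (mem_between.1 hU').2.2⟩))
  · have hNP : (N : ℝ) ≤ P.card := by exact_mod_cast hP1
    have hpos : (0 : ℝ) < (1 / 4) ^ d := by positivity
    refine le_trans (expect_le_expect fun U' hU' => ind_mono fun h => ?_)
      (expect_few_petals_le heU hev hv (P := P) (fun A hA => ⟨hP2 A hA, (hM A (hPM hA)).1⟩) hP3
        (ρ := (1 / 4) ^ d) (N := N₁) (fun A hA => ?_) (by nlinarith) (by nlinarith))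
    · have := hred U' hU' h
      by_contra hcon
      refine this (Or.inr ⟨P.filter (· ⊆ U'), filter_subset_filter _ hPM, not_lt.1 hcon,
        fun A hA => hP2 A (mem_filter.1 hA).1, fun A hA A' hA' hne =>
          hP3 A (mem_filter.1 hA).1 A' (mem_filter.1 hA').1 hne⟩)
    · have hA' := hM A (hPM hA)
      have : (A.card : ℝ) ≤ d := by exact_mod_cast hA'.2
      exact pow_mul_card_between_le (by norm_num) (by norm_num) (hP2 A hA) hA'.1
        (by omega) (by omega) hv (by linarith)

end Rich

section Pruning

variable {V : Type*} [Fintype V] [DecidableEq V]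

/-- The expected number of members of `H` that contain `e` and lie in a random `t`-set, given that
the random set contains `e`. -/
noncomputable def relDegree (t : ℕ) (H : Finset (Finset V)) (e : Finset V) : ℝ :=
  ∑ e₂ ∈ H, ind (e ⊆ e₂) * (((supersets e₂ t).card : ℝ) / (supersets e t).card)

/-- A family of small sets has a subfamily in which all relative degrees are bounded, such that
every member of the family contains a set of relative degree at least one. -/
theorem exists_pruned_family {t d : ℕ} (hdt : d ≤ t) (ht : t ≤ Fintype.card V)
    {W : Finset V} {H : Finset (Finset V)} (hH : ∀ e ∈ H, W ⊆ e ∧ e.card ≤ d) :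
    ∃ H' ⊆ H, (∀ e, W ⊆ e → e.card ≤ d → relDegree t H' e ≤ 2) ∧
      ∀ e ∈ H, ∃ e' ⊆ e, W ⊆ e' ∧ 1 ≤ relDegree t H' e' := by
  classical
  have hc : ∀ e : Finset V, e.card ≤ d → (0 : ℝ) < (supersets e t).card := fun e he =>
    card_between_pos (subset_univ _) (he.trans hdt) (by simpa using ht)
  obtain ⟨H', hH', hmax⟩ := exists_max_image
    (H.powerset.filter fun H' => ∀ e, W ⊆ e → e.card ≤ d → relDegree t H' e ≤ 2) card
    ⟨∅, mem_filter.2 ⟨empty_mem_powerset _, fun e _ _ => by simp [relDegree]⟩⟩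
  rw [mem_filter, mem_powerset] at hH'
  refine ⟨H', hH'.1, hH'.2, fun e he => ?_⟩
  by_cases heH' : e ∈ H'
  · refine ⟨e, Subset.refl e, (hH e he).1, ?_⟩
    have : ind (e ⊆ e) * (((supersets e t).card : ℝ) / (supersets e t).card) ≤
        relDegree t H' e :=
      single_le_sum (f := fun e₂ => ind (e ⊆ e₂) *
        (((supersets e₂ t).card : ℝ) / (supersets e t).card))
        (fun e₂ _ => mul_nonneg (ind_nonneg _) (by positivity)) heH'
    rwa [ind_true (Subset.refl e), one_mul, div_self (hc e (hH e he).2).ne'] at this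
  · by_contra hcon
    push Not at hcon
    have hins : insert e H' ∈
        H.powerset.filter fun H' => ∀ e, W ⊆ e → e.card ≤ d → relDegree t H' e ≤ 2 := by
      rw [mem_filter, mem_powerset]
      refine ⟨insert_subset he hH'.1, fun e' hWe' he'd => ?_⟩
      rw [relDegree, sum_insert heH']
      by_cases hsub : e' ⊆ e
      · have h1 := hcon e' hsub hWe'
        have h2 : ((supersets e t).card : ℝ) / (supersets e' t).card ≤ 1 := by
          rw [div_le_one (hc e' he'd)]
          exact_mod_cast card_le_card (between_subset_between hsub _ _)
        rw [ind_true hsub, one_mul]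
        rw [relDegree] at h1
        linarith
      · rw [ind_false hsub, zero_mul, zero_add]
        exact hH'.2 e' hWe' he'd
    have := hmax _ hins
    rw [card_insert_of_notMem heH'] at this
    omega

/-- If all relative degrees of a family are bounded, then the number of its members inside a
random set has a second moment comparable to its mean. -/
theorem expect_sq_le_of_relDegree_le {t d : ℕ} (hdt : d ≤ t) (ht : t ≤ Fintype.card V)
    {W : Finset V} {H : Finset (Finset V)} (hH : ∀ e ∈ H, W ⊆ e ∧ e.card ≤ d)
    (hdeg : ∀ e, W ⊆ e → e.card ≤ d → relDegree t H e ≤ 2) :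
    𝔼 T ∈ supersets W t, (∑ e ∈ H, ind (e ⊆ T)) ^ 2 ≤
      2 ^ (d + 1) * 𝔼 T ∈ supersets W t, ∑ e ∈ H, ind (e ⊆ T) := by
  have hc : ∀ e : Finset V, e.card ≤ d → (0 : ℝ) < (supersets e t).card := fun e he =>
    card_between_pos (subset_univ _) (he.trans hdt) (by simpa using ht)
  have hsq : ∀ T : Finset V, (∑ e ∈ H, ind (e ⊆ T)) ^ 2 =
      ∑ e ∈ H, ∑ e₂ ∈ H, ind (e ∪ e₂ ⊆ T) := by
    intro T
    rw [sq, sum_mul_sum]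
    refine sum_congr rfl fun A _ => sum_congr rfl fun A' _ => ?_
    rw [← ind_and, union_subset_iff]
  simp only [hsq]
  rw [expect_sum_comm, expect_sum_comm, mul_sum]
  refine sum_le_sum fun e he => ?_
  have hWd : W.card ≤ d := (card_le_card (hH e he).1).trans (hH e he).2
  have hcW := hc W hWd
  rw [expect_sum_comm, expect_between_ind (hH e he).1]
  have h1 : ∀ e₂ ∈ H, 𝔼 T ∈ supersets W t, ind (e ∪ e₂ ⊆ T) ≤
      ((supersets e t).card : ℝ) / (supersets W t).card *
        ∑ e' ∈ e.powerset.filter (W ⊆ ·),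
          ind (e' ⊆ e₂) * (((supersets e₂ t).card : ℝ) / (supersets e' t).card) := by
    intro e₂ he₂
    rw [expect_between_ind ((hH e he).1.trans subset_union_left)]
    have hmem : e ∩ e₂ ∈ e.powerset.filter (W ⊆ ·) := by
      rw [mem_filter, mem_powerset]
      exact ⟨inter_subset_left, subset_inter (hH e he).1 (hH e₂ he₂).1⟩
    have h2 := single_le_sum (f := fun e' => ind (e' ⊆ e₂) *
        (((supersets e₂ t).card : ℝ) / (supersets e' t).card))
        (fun e₂ _ => mul_nonneg (ind_nonneg _) (by positivity)) hmem
    rw [ind_true inter_subset_right, one_mul] at h2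
    refine le_trans ?_ (mul_le_mul_of_nonneg_left h2 (by positivity))
    have hci := hc (e ∩ e₂) ((card_le_card inter_subset_left).trans (hH e he).2)
    rw [div_mul_div_comm, div_le_div_iff₀ hcW (by positivity)]
    have := card_between_log_concave (S := univ) (u := t) (subset_univ e) (subset_univ e₂)
      (by simpa using ht)
    calc ((between (e ∪ e₂) univ t).card : ℝ) * ((between W univ t).card *
          (between (e ∩ e₂) univ t).card) = ((between (e ∪ e₂) univ t).card *
          (between (e ∩ e₂) univ t).card) * (between W univ t).card := by ring
      _ ≤ _ := by gcongr
  refine (sum_le_sum h1).trans ?_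
  rw [← mul_sum, sum_comm, mul_comm]
  gcongr
  calc ∑ e' ∈ e.powerset.filter (W ⊆ ·), relDegree t H e'
      ≤ ∑ e' ∈ e.powerset.filter (W ⊆ ·), (2 : ℝ) := by
        refine sum_le_sum fun e' he' => ?_
        rw [mem_filter, mem_powerset] at he'
        exact hdeg e' he'.2 ((card_le_card he'.1).trans (hH e he).2)
    _ = ((e.powerset.filter (W ⊆ ·)).card : ℝ) * 2 := by simp
    _ ≤ (2 ^ d : ℝ) * 2 := by
        gcongr
        have : (e.powerset.filter (W ⊆ ·)).card ≤ 2 ^ d :=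
          (card_filter_le _ _).trans (by
            rw [card_powerset]; exact Nat.pow_le_pow_right (by norm_num) (hH e he).2)
        exact_mod_cast this
    _ = 2 ^ (d + 1) := by ring

theorem expect_ind_subset_le {t k s d : ℕ} {W e : Finset V} (hWe : W ⊆ e) (hed : e.card ≤ d)
    (hdt : d ≤ t) (htk : t ≤ k) (hk : k ≤ Fintype.card V) (hsk : s ≤ k) (hWs : W.card ≤ s)
    (hr : (1 / 4 : ℝ) * k ≤ (t : ℝ) - d + 1) :
    𝔼 U ∈ supersets W s, ind (e ⊆ U) ≤ 4 ^ d * 𝔼 T ∈ supersets W t, ind (e ⊆ T) := by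
  have hWd : W.card ≤ d := (card_le_card hWe).trans hed
  have hed' : (e.card : ℝ) ≤ d := by exact_mod_cast hed
  have h1 : 𝔼 U ∈ supersets W s, ind (e ⊆ U) ≤ 𝔼 S ∈ supersets W k, ind (e ⊆ S) := by
    have := expect_supersets_comm hWs hsk hk fun U _ => ind (e ⊆ U)
    have e2 : 𝔼 U ∈ supersets W s, 𝔼 S ∈ supersets U k, ind (e ⊆ U) =
        𝔼 U ∈ supersets W s, ind (e ⊆ U) := by
      refine expect_congr rfl fun U hU => ?_
      rw [mem_supersets] at hU
      exact expect_const (supersets_nonempty (hU.1.le.trans hsk) hk) _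
    rw [e2] at this
    rw [← this]
    refine expect_le_expect fun S hS => ?_
    rw [mem_supersets] at hS
    refine expect_le (between_nonempty hS.2 hWs (by omega)) fun U hU => ?_
    rw [mem_between] at hU
    exact ind_mono fun h => h.trans hU.1
  have h2 : (1 / 4) ^ d * 𝔼 S ∈ supersets W k, ind (e ⊆ S) ≤
      𝔼 T ∈ supersets W t, ind (e ⊆ T) := by
    have := expect_supersets_comm (hWd.trans hdt) htk hk fun U _ => ind (e ⊆ U)
    have e2 : 𝔼 U ∈ supersets W t, 𝔼 S ∈ supersets U k, ind (e ⊆ U) =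
        𝔼 U ∈ supersets W t, ind (e ⊆ U) := by
      refine expect_congr rfl fun U hU => ?_
      rw [mem_supersets] at hU
      exact expect_const (supersets_nonempty (hU.1.le.trans htk) hk) _
    rw [e2] at this
    rw [← this, mul_expect]
    refine expect_le_expect fun S hS => ?_
    rw [mem_supersets] at hS
    by_cases heS : e ⊆ S
    · rw [ind_true heS, mul_one, expect_between_ind hWe, le_div_iff₀
        (card_between_pos hS.2 (hWd.trans hdt) (by omega))]
      exact pow_mul_card_between_le (by norm_num) (by norm_num) hWe heS (by omega) (by omega)
        (by omega) (by rw [hS.1]; linarith)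
    · rw [ind_false heS, mul_zero]
      exact expect_nonneg fun _ _ => ind_nonneg _
  have h3 : (4 : ℝ) ^ d * (1 / 4) ^ d = 1 := by rw [← mul_pow]; norm_num
  calc 𝔼 U ∈ supersets W s, ind (e ⊆ U) ≤ 𝔼 S ∈ supersets W k, ind (e ⊆ S) := h1
    _ = 4 ^ d * ((1 / 4) ^ d * 𝔼 S ∈ supersets W k, ind (e ⊆ S)) := by
        rw [← mul_assoc, h3, one_mul]
    _ ≤ _ := by gcongr

/-- The reverse union bound: if every set in `H` makes the average of `q` large, then few sets
contain a member of `H`. -/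
theorem expect_hit_le {t k s d : ℕ} {W : Finset V} (hWd : W.card ≤ d)
    (hdt : d ≤ t) (htk : t ≤ k) (hk : k ≤ Fintype.card V) (hsk : s ≤ k) (hWs : W.card ≤ s)
    (hr : (1 / 4 : ℝ) * k ≤ (t : ℝ) - d + 1) {q : Finset V → ℝ} (hq0 : ∀ T, 0 ≤ q T)
    (hq1 : ∀ T, q T ≤ 1) {ε₀ : ℝ} (hε₀ : 0 < ε₀) {H : Finset (Finset V)}
    (hH : ∀ e ∈ H, W ⊆ e ∧ e.card ≤ d) (hHq : ∀ e ∈ H, ε₀ ≤ 𝔼 T ∈ supersets e t, q T) :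
    𝔼 U ∈ supersets W s, ind (∃ e ∈ H, e ⊆ U) ≤
      4 ^ d * 2 ^ d * 2 ^ (d + 1) / ε₀ ^ 2 * 𝔼 T ∈ supersets W t, q T := by
  classical
  have ht : t ≤ Fintype.card V := htk.trans hk
  have hc : ∀ e : Finset V, e.card ≤ d → (0 : ℝ) < (supersets e t).card := fun e he =>
    card_between_pos (subset_univ _) (he.trans hdt) (by simpa using ht)
  have hcW := hc W hWd
  obtain ⟨H', hH'H, hdeg, hcov⟩ := exists_pruned_family hdt ht hH
  have hH' : ∀ e ∈ H', W ⊆ e ∧ e.card ≤ d := fun e he => hH e (hH'H he)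
  set ν : ℝ := 𝔼 T ∈ supersets W t, ∑ e ∈ H', ind (e ⊆ T) with hν
  have hν0 : 0 ≤ ν := expect_nonneg fun T _ => sum_nonneg fun e _ => ind_nonneg _
  have hνsum : ν = ∑ e ∈ H', ((supersets e t).card : ℝ) / (supersets W t).card := by
    rw [hν, expect_sum_comm]
    exact sum_congr rfl fun e he => expect_between_ind (hH' e he).1 _ _
  set Q : ℝ := 𝔼 T ∈ supersets W t, q T with hQ
  have hQ0 : 0 ≤ Q := expect_nonneg fun T _ => hq0 T
  have hsec := expect_sq_le_of_relDegree_le hdt ht hH' hdeg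
  rw [← hν] at hsec
  have hNq : ε₀ * ν ≤ 𝔼 T ∈ supersets W t, (∑ e ∈ H', ind (e ⊆ T)) * q T := by
    simp only [sum_mul]
    rw [expect_sum_comm, hνsum, mul_sum]
    refine sum_le_sum fun e he => ?_
    have h1 := hHq e (hH'H he)
    rw [expect_eq_sum_div_card, le_div_iff₀ (hc e (hH' e he).2)] at h1
    rw [expect_eq_sum_div_card, sum_between_ind_mul (hH' e he).1, mul_div_assoc']
    gcongr
  have hν1 : ν ≤ 2 ^ (d + 1) / ε₀ ^ 2 * Q := by
    have hcs := expect_mul_sq_le_sq_mul_sq (supersets W t)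
      (fun T => ∑ e ∈ H', ind (e ⊆ T)) q
    have hqq : 𝔼 T ∈ supersets W t, q T ^ 2 ≤ Q := expect_le_expect fun T _ => by
      have := hq0 T; have := hq1 T; nlinarith
    have h1 : (ε₀ * ν) ^ 2 ≤ 2 ^ (d + 1) * ν * Q :=
      calc (ε₀ * ν) ^ 2 ≤ _ := by
            apply pow_le_pow_left₀ (by positivity) hNq
        _ ≤ _ := hcs
        _ ≤ _ := by
            apply mul_le_mul hsec hqq (expect_nonneg fun T _ => sq_nonneg _) (by positivity)
    rcases hν0.eq_or_lt with h0 | h0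
    · rw [← h0]; positivity
    · rw [div_mul_eq_mul_div, le_div_iff₀ (by positivity)]
      refine le_of_mul_le_mul_right ?_ h0
      nlinarith
  let G : Finset (Finset V) :=
    univ.filter fun e' => W ⊆ e' ∧ e'.card ≤ d ∧ 1 ≤ relDegree t H' e'
  have hG : ∀ U, ind (∃ e ∈ H, e ⊆ U) ≤ ∑ e' ∈ G, ind (e' ⊆ U) := by
    intro U
    by_cases h : ∃ e ∈ H, e ⊆ U
    · obtain ⟨e, he, heU⟩ := h
      obtain ⟨e', he'e, hWe', hdeg'⟩ := hcov e he
      have hmem : e' ∈ G := mem_filter.2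
        ⟨mem_univ _, hWe', (card_le_card he'e).trans (hH e he).2, hdeg'⟩
      refine (ind_le_one _).trans ?_
      rw [← ind_true (he'e.trans heU)]
      exact single_le_sum (f := fun e' => ind (e' ⊆ U)) (fun _ _ => ind_nonneg _) hmem
    · rw [ind_false h]
      exact sum_nonneg fun _ _ => ind_nonneg _
  calc 𝔼 U ∈ supersets W s, ind (∃ e ∈ H, e ⊆ U)
      ≤ 𝔼 U ∈ supersets W s, ∑ e' ∈ G, ind (e' ⊆ U) := expect_le_expect fun U _ => hG U
    _ = ∑ e' ∈ G, 𝔼 U ∈ supersets W s, ind (e' ⊆ U) := expect_sum_comm _ _ _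
    _ ≤ ∑ e' ∈ G, 4 ^ d * ∑ e ∈ H', ind (e' ⊆ e) *
          (((supersets e t).card : ℝ) / (supersets W t).card) := by
        refine sum_le_sum fun e' he' => ?_
        obtain ⟨-, h1, h2, h3⟩ := mem_filter.1 he'
        refine (expect_ind_subset_le h1 h2 hdt htk hk hsk hWs hr).trans ?_
        gcongr
        rw [expect_between_ind h1]
        have hpos := hc e' h2
        calc ((supersets e' t).card : ℝ) / (supersets W t).card
            ≤ ((supersets e' t).card : ℝ) / (supersets W t).card * relDegree t H' e' :=
              le_mul_of_one_le_right (by positivity) h3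
          _ = _ := by
              rw [relDegree, mul_sum]
              refine sum_congr rfl fun e _ => ?_
              field_simp
    _ = 4 ^ d * ∑ e ∈ H', (∑ e' ∈ G, ind (e' ⊆ e)) *
          (((supersets e t).card : ℝ) / (supersets W t).card) := by
        rw [← mul_sum, sum_comm]
        simp only [sum_mul]
    _ ≤ 4 ^ d * ∑ e ∈ H', 2 ^ d * (((supersets e t).card : ℝ) / (supersets W t).card) := by
        gcongr with e he
        rw [sum_ind_eq_card_filter]
        have : (G.filter (· ⊆ e)).card ≤ 2 ^ d := by
          calc (G.filter (· ⊆ e)).card ≤ e.powerset.card :=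
                card_le_card fun x hx => mem_powerset.2 (mem_filter.1 hx).2
            _ ≤ 2 ^ d := by
                rw [card_powerset]; exact Nat.pow_le_pow_right (by norm_num) (hH' e he).2
        exact_mod_cast this
    _ = 4 ^ d * 2 ^ d * ν := by rw [← mul_sum, hνsum]; ring
    _ ≤ 4 ^ d * 2 ^ d * (2 ^ (d + 1) / ε₀ ^ 2 * Q) := by gcongr
    _ = _ := by ring

end Pruning

section Consistent

variable {V : Type*} [Fintype V] [DecidableEq V]

/-- A system of families `M U` of small subsets of `U`, for `U` of size at most `k`, that is
compatible with restriction up to errors controlled by the averages of `q` over random `t`-sets. -/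
structure IsConsistent (d k t : ℕ) (K₁ : ℝ) (M : Finset V → Finset (Finset V))
    (q : Finset V → ℝ) : Prop where
  mem : ∀ U, ∀ A ∈ M U, A ⊆ U ∧ A.card ≤ d
  q_nonneg : ∀ T, 0 ≤ q T
  q_le_one : ∀ T, q T ≤ 1
  d_le : d ≤ t
  t_le : t ≤ k
  k_le : k ≤ Fintype.card V
  quarter_le : (1 / 4 : ℝ) * k ≤ (t : ℝ) - d + 1
  restrict : ∀ (W : Finset V) (u s : ℕ), W.card ≤ d → W.card ≤ u → u ≤ s → s ≤ k →
    𝔼 U ∈ supersets W s, 𝔼 U' ∈ between W U u, ind (M U' ≠ (M U).filter (· ⊆ U')) ≤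
      K₁ * 𝔼 T ∈ supersets W t, q T
  member : ∀ (A : Finset V) (s : ℕ), A.card ≤ d → A.card ≤ s → s ≤ k →
    𝔼 U ∈ supersets A s, ind (A ∈ M U) ≤ K₁ * 𝔼 T ∈ supersets A t, q T

theorem expect_supersets_expect_supersets {W : Finset V} {j t : ℕ} (h1 : W.card ≤ j) (h2 : j ≤ t)
    (h3 : t ≤ Fintype.card V) (q : Finset V → ℝ) :
    𝔼 e ∈ supersets W j, 𝔼 T ∈ supersets e t, q T = 𝔼 T ∈ supersets W t, q T := by
  rw [← expect_supersets_comm h1 h2 h3 fun _ T => q T]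
  refine expect_congr rfl fun T hT => ?_
  rw [mem_supersets] at hT
  exact expect_const (between_nonempty hT.2 h1 (by omega)) _

theorem choose_le_four_pow_mul {s v j d : ℕ} (hjd : j ≤ d) (hjv : j ≤ v) (hvs : v ≤ s)
    (h : (1 / 4 : ℝ) * s ≤ (v : ℝ) - j + 1) :
    (s.choose j : ℝ) ≤ 4 ^ d * (v.choose j : ℝ) := by
  have h1 := pow_mul_choose_le (r := 1 / 4) (by norm_num) hvs j hjv h
  have h2 : (s.choose v : ℝ) * (v.choose j) = s.choose j * (s - j).choose (v - j) := by
    exact_mod_cast Nat.choose_mul hjv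
  have hpos : (0 : ℝ) < s.choose v := by exact_mod_cast Nat.choose_pos hvs
  have h3 : (4 : ℝ) ^ j * (1 / 4) ^ j = 1 := by rw [← mul_pow]; norm_num
  have h4 : (s.choose j : ℝ) ≤ 4 ^ j * (v.choose j : ℝ) := by
    refine le_of_mul_le_mul_left ?_ hpos
    calc (s.choose v : ℝ) * s.choose j
        = 4 ^ j * (s.choose j * ((1 / 4) ^ j * s.choose v)) := by
          linear_combination (-(s.choose v : ℝ) * s.choose j) * h3
      _ ≤ 4 ^ j * (s.choose j * (s - j).choose (v - j)) := by gcongr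
      _ = s.choose v * (4 ^ j * v.choose j) := by rw [← h2]; ring
  refine h4.trans ?_
  gcongr
  norm_num

/-- The expected number of kernels, of a given size, that are not exceptional. -/
theorem IsConsistent.expect_sum_isKernel_le {d k t : ℕ} {K₁ : ℝ} {M : Finset V → Finset (Finset V)}
    {q : Finset V → ℝ} (h : IsConsistent d k t K₁ M q) {W : Finset V} {s v j N N' : ℕ}
    (hWj : W.card ≤ j) (hjd : j ≤ d) (hs : 4 * d ≤ s) (hsk : s ≤ k) (hv : v = s / 2)
    (hN1 : 2 * ((d * N' + 1 : ℕ) : ℝ) ≤ (1 / 4) ^ d * N) (hN2 : (32 : ℝ) ≤ (1 / 4) ^ d * N)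
    {Good : Finset V → Prop} {c₀ : ℝ} (hc₀ : 0 ≤ c₀)
    (hGood : ∀ e, Good e → W ⊆ e → e.card = j →
      𝔼 U ∈ supersets e v, ind (∃ A ∈ M U, e ⊆ A) ≤ c₀) :
    𝔼 U ∈ supersets W s, ∑ e ∈ between W U j,
        ind (Good e ∧ IsKernel W N N' ((M U).filter (W ⊆ ·)) e) ≤
      4 / 3 * 4 ^ d * kernelBound d N' d *
        (c₀ * 𝔼 U ∈ supersets W v, ind (∃ A ∈ M U, W ⊆ A) +
          2 * K₁ * 𝔼 T ∈ supersets W t, q T) := by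
  have hvs : v ≤ s := by omega
  have h2v : 2 * v ≤ s := by omega
  have hdv : d ≤ v := by omega
  have hsn : s ≤ Fintype.card V := hsk.trans h.k_le
  have hsv : (s : ℝ) ≤ 2 * v + 1 := by exact_mod_cast (by omega : s ≤ 2 * v + 1)
  have hs' : 4 * (d : ℝ) ≤ s := by exact_mod_cast hs
  have hjd' : (j : ℝ) ≤ d := by exact_mod_cast hjd
  have hquart : (1 / 4 : ℝ) * s ≤ (v : ℝ) - d + 1 := by linarith
  have hNpos : 0 < N := by
    rcases Nat.eq_zero_or_pos N with h0 | h0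
    · rw [h0] at hN2; norm_num at hN2
    · exact h0
  have hNN' : d * N' + 1 ≤ N := by
    have h1 : ((1 / 4 : ℝ)) ^ d ≤ 1 := pow_le_one₀ (by norm_num) (by norm_num)
    have h2 : ((d * N' + 1 : ℕ) : ℝ) ≤ N := by
      have : (0 : ℝ) ≤ N := Nat.cast_nonneg N
      have : (0 : ℝ) ≤ ((d * N' + 1 : ℕ) : ℝ) := Nat.cast_nonneg _
      nlinarith
    exact_mod_cast h2
  set MW : Finset V → Finset (Finset V) := fun U => (M U).filter (W ⊆ ·) with hMW
  have hMWmem : ∀ U, ∀ A ∈ MW U, A ⊆ U ∧ A.card ≤ d := fun U A hA =>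
    h.mem U A (mem_filter.1 hA).1
  let D : Finset V → Finset V → ℝ := fun U' U => ind (M U' ≠ (M U).filter (· ⊆ U'))
  have hD0 : ∀ U' U, 0 ≤ D U' U := fun _ _ => ind_nonneg _
  let Es : Finset V → ℝ := fun e =>
    𝔼 U ∈ supersets e v, ind (IsKernel W (d * N' + 1) N' (MW U) e)
  let err : Finset V → ℝ := fun e =>
    𝔼 U ∈ supersets e s, ind (IsKernel W N N' (MW U) e) * 𝔼 U' ∈ between e U v, D U' U
  have herr0 : ∀ e, 0 ≤ err e := fun e =>
    expect_nonneg fun U _ => mul_nonneg (ind_nonneg _) (expect_nonneg fun U' _ => hD0 _ _)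
  have hEs0 : ∀ e, 0 ≤ Es e := fun e => expect_nonneg fun U _ => ind_nonneg _
  have step1 : ∀ e ∈ supersets W j, 𝔼 U ∈ supersets e s,
      ind (Good e ∧ IsKernel W N N' (MW U) e) ≤ 4 / 3 * (c₀ * Es e + 2 * err e) := by
    intro e he
    rw [mem_supersets] at he
    by_cases hg : Good e
    swap
    · refine le_trans (expect_le_expect (g := fun _ => 0) fun U _ => ?_) ?_
      · rw [ind_false fun h => hg h.1]
      · rw [expect_const_zero]
        have := herr0 e; have := hEs0 e; positivity
    have hev : e.card ≤ v := by omega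
    have hG := expect_le_sq_add hev h2v hsn (fun U => IsKernel W N N' (MW U) e)
      (fun U => IsKernel W (d * N' + 1) N' (MW U) e)
    have hE : 𝔼 U ∈ supersets e s, ind (Good e ∧ IsKernel W N N' (MW U) e) =
        𝔼 U ∈ supersets e s, ind (IsKernel W N N' (MW U) e) :=
      expect_congr rfl fun U _ => ind_congr (by tauto)
    rw [hE]
    set E : ℝ := 𝔼 U ∈ supersets e s, ind (IsKernel W N N' (MW U) e) with hEdef
    have hEs : Es e ≤ c₀ := by
      refine le_trans (expect_le_expect fun U hU => ind_mono fun hk => ?_) (hGood e hg he.2 he.1)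
      obtain ⟨A, hA, heA⟩ := hk.2.1.exists_superset (Nat.succ_pos _)
      exact ⟨A, (mem_filter.1 hA).1, heA⟩
    have hloss : 𝔼 U ∈ supersets e s, 𝔼 U' ∈ between e U v,
        ind (IsKernel W N N' (MW U) e ∧ ¬ IsKernel W (d * N' + 1) N' (MW U') e) ≤
        1 / 8 * E + err e := by
      rw [hEdef, mul_expect, ← expect_add_distrib]
      refine expect_le_expect fun U hU => ?_
      rw [mem_supersets] at hU
      by_cases hk : IsKernel W N N' (MW U) e
      · rw [ind_true hk, mul_one, one_mul]
        refine le_trans ?_ (add_le_add_left (expect_not_isKernel_le (hMWmem U) hNpos hk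
          (hU.1.symm ▸ hvs) hdv (hU.1.symm ▸ hquart) hN1 hN2) _)
        rw [add_comm, ← expect_add_distrib]
        refine expect_le_expect fun U' _ => ?_
        rw [add_comm]
        refine (ind_le_add fun hk' => ?_)
        by_cases hMM : M U' = (M U).filter (· ⊆ U')
        · left
          have : MW U' = (MW U).filter (· ⊆ U') := by
            rw [hMW]; simp only [hMM]; exact filter_comm _ _ _
          rw [← this]; exact hk'.2
        · exact Or.inr hMM
      · rw [ind_false hk]
        refine le_trans (expect_le_expect (g := fun _ => 0) fun U' _ => ?_) ?_
        · rw [ind_false fun h => hk h.1]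
        · simp
    have hEs0' := hEs0 e
    have hG' : E ≤ Es e ^ 2 + 2 * (1 / 8 * E + err e) :=
      hG.trans (by simp only [Es]; gcongr)
    nlinarith
  have hjv : j ≤ v := hjd.trans hdv
  rw [expect_sum_between hWj (hjv.trans hvs) hsn]
  have hEsum : ((v - W.card).choose (j - W.card) : ℝ) * 𝔼 e ∈ supersets W j, Es e ≤
      kernelBound d N' d * 𝔼 U ∈ supersets W v, ind (∃ A ∈ M U, W ⊆ A) := by
    rw [← expect_sum_between hWj hjv (hvs.trans hsn), mul_expect]
    refine expect_le_expect fun U _ => ?_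
    by_cases hex : ∃ A ∈ M U, W ⊆ A
    · rw [ind_true hex, mul_one]
      exact sum_ind_isKernel_le (fun A hA => (hMWmem U A hA).2) _
    · rw [ind_false hex, mul_zero]
      refine (sum_eq_zero fun e _ => ind_false fun hk => hex ?_).le
      obtain ⟨A, hA, -⟩ := hk.2.1.exists_superset (Nat.succ_pos _)
      exact ⟨A, mem_filter.1 hA⟩
  have hchoose : ((s - W.card).choose (j - W.card) : ℝ) ≤
      4 ^ d * ((v - W.card).choose (j - W.card) : ℝ) := by
    refine choose_le_four_pow_mul (by omega) (by omega) (by omega) ?_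
    rw [Nat.cast_sub (by omega), Nat.cast_sub (by omega), Nat.cast_sub hWj]
    have : (0 : ℝ) ≤ W.card := Nat.cast_nonneg _
    linarith
  have herrsum : ((s - W.card).choose (j - W.card) : ℝ) * 𝔼 e ∈ supersets W j, err e ≤
      4 ^ d * kernelBound d N' d * (K₁ * 𝔼 T ∈ supersets W t, q T) := by
    rw [← expect_sum_between hWj (hjv.trans hvs) hsn]
    refine le_trans ?_ (mul_le_mul_of_nonneg_left
      (h.restrict W v s (hWj.trans hjd) (hWj.trans hjv) hvs hsk) (by positivity))
    rw [mul_expect]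
    refine expect_le_expect fun U hU => ?_
    rw [mem_supersets] at hU
    have hb : ∀ e ∈ between W U j, ind (IsKernel W N N' (MW U) e) * 𝔼 U' ∈ between e U v, D U' U ≤
        ind (IsKernel W (d * N' + 1) N' (MW U) e) * (4 ^ d * 𝔼 U' ∈ between W U v, D U' U) := by
      intro e he
      rw [mem_between] at he
      refine mul_le_mul (ind_mono fun hk => ⟨hk.1, hk.2.1.anti hNN', hk.2.2⟩) ?_
        (expect_nonneg fun _ _ => hD0 _ _) (ind_nonneg _)
      have := pow_mul_expect_between_le (r := 1 / 4) (by norm_num) (by norm_num) he.2.2 he.1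
        (d := d) (u := v) (by omega) (by omega) (by omega)
        (by rw [hU.1, he.2.1]; linarith) (fun U' => D U' U) (fun U' => hD0 U' U)
      have h3 : (4 : ℝ) ^ d * (1 / 4) ^ d = 1 := by rw [← mul_pow]; norm_num
      calc 𝔼 U' ∈ between e U v, D U' U
          = 4 ^ d * ((1 / 4) ^ d * 𝔼 U' ∈ between e U v, D U' U) := by
            rw [← mul_assoc, h3, one_mul]
        _ ≤ _ := by gcongr
    refine (sum_le_sum hb).trans ?_
    rw [← sum_mul]
    have := sum_ind_isKernel_le (W := W) (N := N') (fun A hA => (hMWmem U A hA).2) (between W U j)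
    calc _ ≤ (kernelBound d N' d : ℝ) * (4 ^ d * 𝔼 U' ∈ between W U v, D U' U) := by
          apply mul_le_mul_of_nonneg_right this
          exact mul_nonneg (by positivity) (expect_nonneg fun _ _ => hD0 _ _)
      _ = _ := by ring
  have hE0 : 0 ≤ 𝔼 e ∈ supersets W j, Es e := expect_nonneg fun e _ => hEs0 e
  have hstep := mul_le_mul_of_nonneg_left (expect_le_expect step1)
    (Nat.cast_nonneg ((s - W.card).choose (j - W.card)) : (0 : ℝ) ≤ _)
  rw [← mul_expect, expect_add_distrib, ← mul_expect, ← mul_expect] at hstep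
  have hEs' := (mul_le_mul_of_nonneg_right hchoose hE0).trans_eq (mul_assoc _ _ _)
  have hEs'' := mul_le_mul_of_nonneg_left
    (hEs'.trans (mul_le_mul_of_nonneg_left hEsum (by positivity))) hc₀
  refine hstep.trans ?_
  generalize (𝔼 e ∈ supersets W j, Es e) = x at *
  generalize (𝔼 e ∈ supersets W j, err e) = y at *
  generalize (𝔼 U ∈ supersets W v, ind (∃ A ∈ M U, W ⊆ A)) = β at *
  generalize (𝔼 T ∈ supersets W t, q T) = Q at *
  nlinarith only [hEs'', herrsum]

/-- The union bound over all small sets, useful when `s` is bounded. -/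
theorem expect_exists_mem_le {d s b : ℕ} {M : Finset V → Finset (Finset V)}
    (hM : ∀ U, ∀ A ∈ M U, A ⊆ U ∧ A.card ≤ d) {W : Finset V} (hsn : s ≤ Fintype.card V)
    (hsb : s ≤ b) {x : ℝ} (hx0 : 0 ≤ x)
    (hx : ∀ j, W.card ≤ j → j ≤ s → j ≤ d →
      𝔼 A ∈ supersets W j, 𝔼 U ∈ supersets A s, ind (A ∈ M U) ≤ x) :
    𝔼 U ∈ supersets W s, ind (∃ A ∈ M U, W ⊆ A) ≤ (d + 1) * 2 ^ b * x := by
  have h1 : ∀ U ∈ supersets W s, ind (∃ A ∈ M U, W ⊆ A) ≤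
      ∑ j ∈ range (d + 1), ∑ A ∈ between W U j, ind (A ∈ M U) := by
    intro U _
    by_cases hex : ∃ A ∈ M U, W ⊆ A
    · obtain ⟨A, hA, hWA⟩ := hex
      have hAU := hM U A hA
      refine (ind_le_one _).trans ?_
      rw [← ind_true hA]
      refine (single_le_sum (f := fun A => ind (A ∈ M U)) (fun _ _ => ind_nonneg _)
        (mem_between.2 ⟨hAU.1, rfl, hWA⟩)).trans ?_
      exact single_le_sum (f := fun j => ∑ A ∈ between W U j, ind (A ∈ M U))
        (fun _ _ => sum_nonneg fun _ _ => ind_nonneg _) (mem_range.2 (by omega))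
    · rw [ind_false hex]
      exact sum_nonneg fun _ _ => sum_nonneg fun _ _ => ind_nonneg _
  refine (expect_le_expect h1).trans ?_
  rw [expect_sum_comm]
  have h2 : ∀ j ∈ range (d + 1), 𝔼 U ∈ supersets W s, ∑ A ∈ between W U j, ind (A ∈ M U) ≤
      2 ^ b * x := by
    intro j hj
    rw [mem_range] at hj
    by_cases hj' : W.card ≤ j ∧ j ≤ s
    · rw [expect_sum_between hj'.1 hj'.2 hsn fun A U => ind (A ∈ M U)]
      have hch : ((s - W.card).choose (j - W.card) : ℝ) ≤ 2 ^ b := by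
        have : (s - W.card).choose (j - W.card) ≤ 2 ^ b :=
          (Nat.choose_le_two_pow _ _).trans (Nat.pow_le_pow_right (by norm_num) (by omega))
        exact_mod_cast this
      exact mul_le_mul hch (hx j hj'.1 hj'.2 (by omega))
        (expect_nonneg fun _ _ => expect_nonneg fun _ _ => ind_nonneg _) (by positivity)
    · have : ∀ U ∈ supersets W s, ∑ A ∈ between W U j, ind (A ∈ M U) ≤ 0 := by
        intro U hU
        rw [mem_supersets] at hU
        have hempty : between W U j = ∅ := by
          refine eq_empty_iff_forall_notMem.2 fun A hA => hj' ?_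
          rw [mem_between] at hA
          exact ⟨hA.2.1 ▸ card_le_card hA.2.2, hA.2.1 ▸ hU.1 ▸ card_le_card hA.1⟩
        rw [hempty, sum_empty]
      refine (expect_le_expect this).trans ?_
      rw [expect_const_zero]; positivity
  refine (sum_le_sum h2).trans (le_of_eq ?_)
  rw [sum_const, card_range, nsmul_eq_mul]
  push_cast
  ring

theorem IsConsistent.expect_nonempty_le_of_le {d k t : ℕ} {K₁ : ℝ}
    {M : Finset V → Finset (Finset V)} {q : Finset V → ℝ} (h : IsConsistent d k t K₁ M q)
    (hK₁ : 0 ≤ K₁) {W : Finset V} {s b : ℕ} (hsk : s ≤ k) (hsb : s ≤ b) :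
    𝔼 U ∈ supersets W s, ind (∃ A ∈ M U, W ⊆ A) ≤
      (d + 1) * 2 ^ b * (K₁ * 𝔼 T ∈ supersets W t, q T) := by
  refine expect_exists_mem_le h.mem (hsk.trans h.k_le) hsb
    (mul_nonneg hK₁ (expect_nonneg fun T _ => h.q_nonneg T)) fun j hWj hjs hjd => ?_
  rw [← expect_supersets_expect_supersets hWj (hjd.trans h.d_le) (h.t_le.trans h.k_le),
    mul_expect]
  refine expect_le_expect fun A hA => ?_
  rw [mem_supersets] at hA
  exact h.member A s (by omega) (by omega) hsk

/-- Parameters for the kernels used in the induction. -/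
def richness (d : ℕ) : ℕ → ℕ
  | 0 => 1
  | r + 1 => 4 ^ d * (32 + 2 * (d * richness d r + 1))

theorem richness_succ (d r : ℕ) :
    (1 / 4 : ℝ) ^ d * (richness d (r + 1) : ℕ) = 32 + 2 * ((d * richness d r + 1 : ℕ) : ℝ) := by
  have h3 : (1 / 4 : ℝ) ^ d * 4 ^ d = 1 := by rw [← mul_pow]; norm_num
  rw [richness]
  push_cast
  rw [← mul_assoc, h3, one_mul]

end Consistent

/-- In a consistent system, few sets `U ⊇ W` have a member of `M U` containing `W`. -/
theorem IsConsistent.exists_expect_nonempty_le (d : ℕ) {K₁ : ℝ} (hK₁ : 0 ≤ K₁) :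
    ∀ l : ℕ, ∃ K : ℝ, 1 ≤ K ∧ ∀ (n k t : ℕ) (M : Finset (Fin n) → Finset (Finset (Fin n)))
      (q : Finset (Fin n) → ℝ), IsConsistent d k t K₁ M q → ∀ (W : Finset (Fin n)) (s : ℕ),
      W.card ≤ d → d ≤ W.card + l → W.card ≤ s → s ≤ k →
      𝔼 U ∈ supersets W s, ind (∃ A ∈ M U, W ⊆ A) ≤ K * 𝔼 T ∈ supersets W t, q T
  | 0 => by
    refine ⟨K₁ + 1, by linarith, fun n k t M q h W s hWd hdW hWs hsk => ?_⟩
    have hQ0 : 0 ≤ 𝔼 T ∈ supersets W t, q T := expect_nonneg fun T _ => h.q_nonneg T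
    have := h.member W s hWd hWs hsk
    refine le_trans (expect_le_expect fun U _ => ind_mono ?_) (this.trans (by nlinarith))
    rintro ⟨A, hA, hWA⟩
    have := h.mem U A hA
    rwa [eq_of_subset_of_card_le hWA (by omega)]
  | l + 1 => by
    classical
    obtain ⟨K', hK', ih⟩ := exists_expect_nonempty_le d hK₁ l
    let a := richness d
    set L : ℝ := (d + 1) * (4 / 3 * 4 ^ d * ∑ r ∈ range (d + 1), (kernelBound d (a r) d : ℝ))
      with hL
    have hL1 : 1 ≤ L := by
      have h1 : (1 : ℝ) ≤ ∑ r ∈ range (d + 1), (kernelBound d (a r) d : ℝ) := by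
        refine le_trans ?_ (single_le_sum (f := fun r => (kernelBound d (a r) d : ℝ))
          (fun _ _ => Nat.cast_nonneg _) (mem_range.2 (Nat.succ_pos d)))
        exact_mod_cast kernelBound_pos _ _ _
      have h2 : (1 : ℝ) ≤ 4 ^ d := one_le_pow₀ (by norm_num)
      have h3 : (0 : ℝ) ≤ d := Nat.cast_nonneg d
      have h4 : 1 ≤ 4 / 3 * 4 ^ d * ∑ r ∈ range (d + 1), (kernelBound d (a r) d : ℝ) := by
        nlinarith
      nlinarith
    set c₀ : ℝ := 1 / (2 * L) with hc₀
    have hc₀pos : 0 < c₀ := by positivity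
    have hLc : L * c₀ = 1 / 2 := by rw [hc₀]; field_simp
    have hc₀1 : c₀ ≤ 1 := by nlinarith
    set ε₀ : ℝ := c₀ / K' with hε₀
    have hε₀pos : 0 < ε₀ := by positivity
    set K₂ : ℝ := 4 ^ d * 2 ^ d * 2 ^ (d + 1) / ε₀ ^ 2 with hK₂
    set K₃ : ℝ := K₂ + L * (2 * K₁) with hK₃
    set K₄ : ℝ := 2 * K₃ + (d + 1) * 2 ^ (4 * d) * K₁ + K' with hK₄
    have hK₂0 : 0 ≤ K₂ := by positivity
    have hK₃0 : 0 ≤ K₃ := by positivity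
    have hbase0 : 0 ≤ ((d : ℝ) + 1) * 2 ^ (4 * d) * K₁ := by positivity
    have hK₄K' : K' ≤ K₄ := by linarith
    have hK₄0 : 0 ≤ K₄ := by linarith
    have hdiv : K₄ ≤ K₄ / c₀ := le_div_self hK₄0 hc₀pos hc₀1
    refine ⟨K₄ / c₀, by linarith, fun n k t M q h W s hWd hdW hWs hsk => ?_⟩
    set Q : ℝ := 𝔼 T ∈ supersets W t, q T with hQ
    have hQ0 : 0 ≤ Q := expect_nonneg fun T _ => h.q_nonneg T
    by_cases hsmall : c₀ < K₄ * Q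
    · refine le_trans (expect_le (supersets_nonempty hWs (hsk.trans h.k_le))
        fun U _ => ind_le_one _) ?_
      rw [div_mul_eq_mul_div, le_div_iff₀ hc₀pos]
      linarith
    rw [not_lt] at hsmall
    suffices hmain : 𝔼 U ∈ supersets W s, ind (∃ A ∈ M U, W ⊆ A) ≤ K₄ * Q from
      hmain.trans (by gcongr)
    induction s using Nat.strong_induction_on with
    | _ s ihs =>
    by_cases hs : s < 4 * d
    · refine (h.expect_nonempty_le_of_le hK₁ hsk hs.le).trans ?_
      rw [← hQ, ← mul_assoc]
      gcongr
      linarith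
    rw [not_lt] at hs
    by_cases hdW' : d ≤ W.card + l
    · exact (ih n k t M q h W s hWd hdW' hWs hsk).trans (by rw [← hQ]; gcongr)
    obtain ⟨v, hv⟩ : ∃ v, v = s / 2 := ⟨_, rfl⟩
    have hWv : W.card ≤ v := by omega
    have hβv := ihs v (by omega) hWv (by omega)
    set β : ℝ := 𝔼 U ∈ supersets W v, ind (∃ A ∈ M U, W ⊆ A) with hβ
    let H : Finset (Finset (Fin n)) :=
      univ.filter fun e => W ⊂ e ∧ e.card ≤ d ∧ ε₀ ≤ 𝔼 T ∈ supersets e t, q T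
    have hHmem : ∀ e, e ∈ H ↔ W ⊂ e ∧ e.card ≤ d ∧ ε₀ ≤ 𝔼 T ∈ supersets e t, q T := by
      intro e; simp [H]
    have hhit := expect_hit_le hWd h.d_le h.t_le h.k_le hsk hWs h.quarter_le h.q_nonneg h.q_le_one
      hε₀pos (H := H) (fun e he => ⟨((hHmem e).1 he).1.1, ((hHmem e).1 he).2.1⟩)
      (fun e he => ((hHmem e).1 he).2.2)
    rw [← hK₂, ← hQ] at hhit
    let Ker : ℕ → Finset (Fin n) → Finset (Fin n) → Prop := fun r U e =>
      e ∉ H ∧ IsKernel W (a (r + 1)) (a r) ((M U).filter (W ⊆ ·)) e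
    have hunion : ∀ U ∈ supersets W s, ind (∃ A ∈ M U, W ⊆ A) ≤ ind (∃ e ∈ H, e ⊆ U) +
        ∑ r ∈ range (d + 1), ∑ j ∈ range (d + 1), ∑ e ∈ between W U j, ind (Ker r U e) := by
      intro U _
      have hsum0 : 0 ≤ ∑ r ∈ range (d + 1), ∑ j ∈ range (d + 1), ∑ e ∈ between W U j,
          ind (Ker r U e) :=
        sum_nonneg fun _ _ => sum_nonneg fun _ _ => sum_nonneg fun _ _ => ind_nonneg _
      by_cases hex : ∃ A ∈ M U, W ⊆ A
      swap
      · rw [ind_false hex]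
        linarith [ind_nonneg (∃ e ∈ H, e ⊆ U)]
      rw [ind_true hex]
      obtain ⟨A, hA, hWA⟩ := hex
      obtain ⟨r, hr, e, he⟩ := exists_isKernel (W := W) a (M := (M U).filter (W ⊆ ·)) d A hWA
        (by have := (h.mem U A hA).2; omega) (Or.inl (mem_filter.2 ⟨hA, hWA⟩))
      have hapos : 0 < a (r + 1) := by simp [a, richness]
      obtain ⟨B, hB, heB⟩ := he.2.1.exists_superset hapos
      have hBU := h.mem U B (mem_filter.1 hB).1
      have heU : e ⊆ U := heB.trans hBU.1
      have hed : e.card ≤ d := (card_le_card heB).trans hBU.2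
      by_cases heH : e ∈ H
      · rw [ind_true ⟨e, heH, heU⟩]
        linarith
      · have hker : Ker r U e := ⟨heH, he⟩
        have h1 : 1 ≤ ∑ e ∈ between W U e.card, ind (Ker r U e) := by
          rw [← ind_true hker]
          exact single_le_sum (f := fun e => ind (Ker r U e)) (fun _ _ => ind_nonneg _)
            (mem_between.2 ⟨heU, rfl, he.1⟩)
        have h2 := single_le_sum (f := fun j => ∑ e ∈ between W U j, ind (Ker r U e))
          (fun _ _ => sum_nonneg fun _ _ => ind_nonneg _) (mem_range.2 (Nat.lt_succ_of_le hed))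
        have h3 := single_le_sum
          (f := fun r => ∑ j ∈ range (d + 1), ∑ e ∈ between W U j, ind (Ker r U e))
          (fun _ _ => sum_nonneg fun _ _ => sum_nonneg fun _ _ => ind_nonneg _)
          (mem_range.2 (Nat.lt_succ_of_le hr))
        linarith [ind_nonneg (∃ e ∈ H, e ⊆ U)]
    have hβ0 : 0 ≤ β := expect_nonneg fun _ _ => ind_nonneg _
    have hker : ∀ r ∈ range (d + 1), ∀ j ∈ range (d + 1),
        𝔼 U ∈ supersets W s, ∑ e ∈ between W U j, ind (Ker r U e) ≤
        4 / 3 * 4 ^ d * kernelBound d (a r) d * (c₀ * β + 2 * K₁ * Q) := by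
      intro r _ j hj
      rw [mem_range] at hj
      by_cases hWj : W.card ≤ j
      · have hrich := richness_succ d r
        refine h.expect_sum_isKernel_le hWj (by omega) hs hsk hv ?_ ?_ hc₀pos.le ?_
        · rw [hrich]; linarith
        · rw [hrich]
          have : (0 : ℝ) ≤ ((d * richness d r + 1 : ℕ) : ℝ) := Nat.cast_nonneg _
          linarith
        · intro e heH hWe hej
          by_cases heW : e = W
          · rw [heW]; exact hβv.trans hsmall
          · have hss : W ⊂ e := hWe.ssubset_of_ne (Ne.symm heW)
            have hlt := card_lt_card hss
            have havg : 𝔼 T ∈ supersets e t, q T ≤ ε₀ := by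
              by_contra hcon
              exact heH ((hHmem e).2 ⟨hss, by omega, (not_le.1 hcon).le⟩)
            refine (ih n k t M q h e v (by omega) (by omega) (by omega) (by omega)).trans ?_
            calc K' * _ ≤ K' * ε₀ := by gcongr
              _ = c₀ := by rw [hε₀]; field_simp
      · have : ∀ U ∈ supersets W s, ∑ e ∈ between W U j, ind (Ker r U e) ≤ 0 := by
          intro U hU
          have hempty : between W U j = ∅ := by
            refine eq_empty_iff_forall_notMem.2 fun A hA => hWj ?_
            rw [mem_between] at hA
            exact hA.2.1 ▸ card_le_card hA.2.2
          rw [hempty, sum_empty]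
        refine (expect_le_expect this).trans ?_
        rw [expect_const_zero]; positivity
    calc 𝔼 U ∈ supersets W s, ind (∃ A ∈ M U, W ⊆ A)
        ≤ 𝔼 U ∈ supersets W s, (ind (∃ e ∈ H, e ⊆ U) +
          ∑ r ∈ range (d + 1), ∑ j ∈ range (d + 1), ∑ e ∈ between W U j, ind (Ker r U e)) :=
          expect_le_expect hunion
      _ = 𝔼 U ∈ supersets W s, ind (∃ e ∈ H, e ⊆ U) + ∑ r ∈ range (d + 1), ∑ j ∈ range (d + 1),
          𝔼 U ∈ supersets W s, ∑ e ∈ between W U j, ind (Ker r U e) := by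
          rw [expect_add_distrib, expect_sum_comm]
          congr 1
          exact sum_congr rfl fun r _ => expect_sum_comm _ _ _
      _ ≤ K₂ * Q + ∑ r ∈ range (d + 1), ∑ j ∈ range (d + 1),
          4 / 3 * 4 ^ d * kernelBound d (a r) d * (c₀ * β + 2 * K₁ * Q) :=
          add_le_add hhit (sum_le_sum fun r hr => sum_le_sum fun j hj => hker r hr j hj)
      _ = K₂ * Q + L * (c₀ * β + 2 * K₁ * Q) := by
          simp only [sum_const, card_range, nsmul_eq_mul]
          rw [hL, ← mul_sum, ← sum_mul, ← mul_sum]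
          push_cast
          ring
      _ = K₃ * Q + L * c₀ * β := by rw [hK₃]; ring
      _ ≤ K₄ * Q := by
          rw [hLc]
          have : 2 * (K₃ * Q) ≤ K₄ * Q := by
            rw [← mul_assoc]; gcongr; linarith
          linarith

section Agreement

variable {V : Type*} [Fintype V] [DecidableEq V] {σ : Type*}

/-- The local functions at `S₁` and `S₂` differ on a subset of `T` of size at most `d`. -/
def Disagree (d : ℕ) (g : Finset V → Finset V → σ) (S₁ S₂ T : Finset V) : Prop :=
  ∃ A ⊆ T, A.card ≤ d ∧ g S₁ A ≠ g S₂ A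

/-- Every pair of `k`-sets containing `W`, moved by a random permutation that fixes `W`, disagrees
with probability at most `b`. -/
def PairsAgree (d k : ℕ) (g : Finset V → Finset V → σ) (W : Finset V) (b : ℝ) : Prop :=
  ∀ S₁ S₂, W ⊆ S₁ → W ⊆ S₂ → S₁.card = k → S₂.card = k →
    𝔼 π ∈ fixers W, ind (Disagree d g (moved π S₁) (moved π S₂) (moved π (S₁ ∩ S₂))) ≤ b

variable {d k t : ℕ} {g : Finset V → Finset V → σ} {W : Finset V}

theorem Disagree.mono {S₁ S₂ T T' : Finset V} (h : Disagree d g S₁ S₂ T) (hT : T ⊆ T') :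
    Disagree d g S₁ S₂ T' := by
  obtain ⟨A, hA, h⟩ := h
  exact ⟨A, hA.trans hT, h⟩

theorem Disagree.symm {S₁ S₂ T : Finset V} (h : Disagree d g S₁ S₂ T) :
    Disagree d g S₂ S₁ T := by
  obtain ⟨A, hA, hd, h⟩ := h
  exact ⟨A, hA, hd, h.symm⟩

theorem Disagree.or {S₁ S₂ T : Finset V} (h : Disagree d g S₁ S₂ T) (S₃ : Finset V) :
    Disagree d g S₁ S₃ T ∨ Disagree d g S₃ S₂ T := by
  obtain ⟨A, hA, hd, h⟩ := h
  by_cases h' : g S₁ A = g S₃ A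
  · exact Or.inr ⟨A, hA, hd, h' ▸ h⟩
  · exact Or.inl ⟨A, hA, hd, h'⟩

theorem pow_mul_expect_disagree_le {r a : ℝ} (hr : 0 ≤ r) (hr1 : r ≤ 1) (hWt : W.card + d ≤ t)
    (hrk : r * k ≤ (t : ℝ) - (W.card + d) + 1)
    (ha : ∀ T S₁ S₂, W ⊆ T → T ⊆ S₁ → T ⊆ S₂ → T.card = t → S₁.card = k → S₂.card = k →
      𝔼 π ∈ fixers W, ind (Disagree d g (moved π S₁) (moved π S₂) (moved π T)) ≤ a)
    {S₁ S₂ : Finset V} (h1 : W ⊆ S₁) (h2 : W ⊆ S₂) (hc1 : S₁.card = k) (hc2 : S₂.card = k)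
    (ht : t ≤ (S₁ ∩ S₂).card) :
    r ^ d * 𝔼 π ∈ fixers W, ind (Disagree d g (moved π S₁) (moved π S₂) (moved π (S₁ ∩ S₂)))
      ≤ a := by
  have hWI : W ⊆ S₁ ∩ S₂ := subset_inter h1 h2
  have hne : (between W (S₁ ∩ S₂) t).Nonempty := between_nonempty hWI (by omega) ht
  have hpt : ∀ π ∈ fixers W,
      r ^ d * ind (Disagree d g (moved π S₁) (moved π S₂) (moved π (S₁ ∩ S₂))) ≤
      𝔼 T ∈ between W (S₁ ∩ S₂) t,
        ind (Disagree d g (moved π S₁) (moved π S₂) (moved π T)) := by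
    intro π _
    by_cases hD : Disagree d g (moved π S₁) (moved π S₂) (moved π (S₁ ∩ S₂))
    · obtain ⟨A', hA', hd, hne'⟩ := hD
      rw [ind_true ⟨A', hA', hd, hne'⟩, mul_one]
      obtain ⟨A, rfl⟩ := (moved_bijective π).2 A'
      rw [moved_subset_moved] at hA'
      rw [card_moved] at hd
      have hcu : (W ∪ A).card ≤ W.card + d := (card_union_le _ _).trans (by omega)
      have hcI : (S₁ ∩ S₂).card ≤ k := hc1 ▸ card_le_card inter_subset_left
      have hcu' : ((W ∪ A).card : ℝ) ≤ W.card + d := by exact_mod_cast hcu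
      have hcI' : ((S₁ ∩ S₂).card : ℝ) ≤ k := by exact_mod_cast hcI
      have key := pow_mul_card_between_le hr hr1 (d := d) (u := t)
        (subset_union_left (s₁ := W) (s₂ := A)) (union_subset hWI hA') (by omega)
        (by omega) ht (by nlinarith)
      have hle : 𝔼 T ∈ between W (S₁ ∩ S₂) t, ind (W ∪ A ⊆ T) ≤ 𝔼 T ∈ between W (S₁ ∩ S₂) t,
          ind (Disagree d g (moved π S₁) (moved π S₂) (moved π T)) := by
        refine expect_le_expect fun T _ => ind_mono fun hT => ⟨moved π A, ?_, ?_, hne'⟩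
        · rw [moved_subset_moved]; exact subset_union_right.trans hT
        · rwa [card_moved]
      refine le_trans ?_ hle
      rw [expect_between_ind subset_union_left, le_div_iff₀ (by exact_mod_cast hne.card_pos)]
      exact key
    · rw [ind_false hD, mul_zero]
      exact expect_nonneg fun _ _ => ind_nonneg _
  rw [mul_expect]
  refine (expect_le_expect hpt).trans ?_
  rw [expect_comm]
  refine expect_le hne fun T hT => ?_
  rw [mem_between] at hT
  exact ha T S₁ S₂ hT.2.2 (hT.1.trans inter_subset_left) (hT.1.trans inter_subset_right) hT.2.1
    hc1 hc2

/-- Agreement of pairs with intersection at least `t` propagates along chains of sets. -/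
theorem expect_disagree_le_of_card_sdiff_le {b : ℝ} (hb : 0 ≤ b) (htk : t ≤ k)
    (h : ∀ S₁ S₂, W ⊆ S₁ → W ⊆ S₂ → S₁.card = k → S₂.card = k → t ≤ (S₁ ∩ S₂).card →
      𝔼 π ∈ fixers W, ind (Disagree d g (moved π S₁) (moved π S₂) (moved π (S₁ ∩ S₂))) ≤ b) :
    ∀ (m : ℕ) (S₁ S₂ : Finset V), W ⊆ S₁ → W ⊆ S₂ → S₁.card = k → S₂.card = k →
      (S₁ \ S₂).card ≤ (m + 1) * (k - t) →
      𝔼 π ∈ fixers W, ind (Disagree d g (moved π S₁) (moved π S₂) (moved π (S₁ ∩ S₂))) ≤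
        (m + 1) * b
  | 0, S₁, S₂, h1, h2, c1, c2, hm => by
    have := card_sdiff_add_card_inter S₁ S₂
    simpa using h S₁ S₂ h1 h2 c1 c2 (by omega)
  | m + 1, S₁, S₂, h1, h2, c1, c2, hm => by
    have hi1 := card_sdiff_add_card_inter S₁ S₂
    have hi2 := card_sdiff_add_card_inter S₂ S₁
    rw [inter_comm S₂ S₁] at hi2
    by_cases hsmall : (S₁ \ S₂).card ≤ k - t
    · have hm0 : (0 : ℝ) ≤ m := Nat.cast_nonneg m
      refine (h S₁ S₂ h1 h2 c1 c2 (by omega)).trans ?_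
      push_cast
      nlinarith
    obtain ⟨P, hP, hPc⟩ := exists_subset_card_eq (s := S₁ \ S₂) (n := k - t) (by omega)
    obtain ⟨R, hR, hRc⟩ := exists_subset_card_eq (s := S₂ \ S₁) (n := k - t) (by omega)
    have hPS : P ⊆ S₁ := hP.trans sdiff_subset
    have hRS : Disjoint (S₁ \ P) R := by
      refine disjoint_left.2 fun x hx hxR => ?_
      exact (mem_sdiff.1 (hR hxR)).2 (mem_sdiff.1 hx).1
    have hIP : S₁ ∩ S₂ ⊆ S₁ \ P := by
      intro x hx
      rw [mem_inter] at hx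
      exact mem_sdiff.2 ⟨hx.1, fun hxP => (mem_sdiff.1 (hP hxP)).2 hx.2⟩
    have hPk : P.card ≤ S₁.card := card_le_card hPS
    set S' : Finset V := (S₁ \ P) ∪ R with hS'
    have hIS' : S₁ ∩ S₂ ⊆ S' := hIP.trans subset_union_left
    have hc' : S'.card = k := by
      rw [hS', card_union_of_disjoint hRS, card_sdiff_of_subset hPS]
      omega
    have hW' : W ⊆ S' := (subset_inter h1 h2).trans hIS'
    have e1 := h S₁ S' h1 hW' c1 hc' (by
      have : S₁ \ P ⊆ S₁ ∩ S' := subset_inter sdiff_subset subset_union_left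
      have := card_le_card this
      rw [card_sdiff_of_subset hPS] at this
      omega)
    have e2 := expect_disagree_le_of_card_sdiff_le hb htk h m S' S₂ hW' h2 hc' c2 (by
      have hsub : S' \ S₂ ⊆ (S₁ \ S₂) \ P := by
        intro x hx
        rw [mem_sdiff, hS', mem_union] at hx
        rcases hx.1 with hx1 | hx1
        · rw [mem_sdiff] at hx1
          exact mem_sdiff.2 ⟨mem_sdiff.2 ⟨hx1.1, hx.2⟩, hx1.2⟩
        · exact absurd (mem_sdiff.1 (hR hx1)).1 hx.2
      have := card_le_card hsub
      rw [card_sdiff_of_subset hP] at this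
      have e3 : (m + 1 + 1) * (k - t) = (m + 1) * (k - t) + (k - t) := by ring
      omega)
    have hsplit : 𝔼 π ∈ fixers W,
        ind (Disagree d g (moved π S₁) (moved π S₂) (moved π (S₁ ∩ S₂))) ≤
        𝔼 π ∈ fixers W, ind (Disagree d g (moved π S₁) (moved π S') (moved π (S₁ ∩ S'))) +
        𝔼 π ∈ fixers W, ind (Disagree d g (moved π S') (moved π S₂) (moved π (S' ∩ S₂))) := by
      rw [← expect_add_distrib]
      refine expect_le_expect fun π _ => ind_le_add fun hD => ?_
      refine (hD.or (moved π S')).imp (fun h => h.mono ?_) fun h => h.mono ?_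
      · rw [moved_subset_moved]; exact subset_inter inter_subset_left hIS'
      · rw [moved_subset_moved]; exact subset_inter hIS' inter_subset_right
    push_cast
    linarith

/-- Agreement on a common subset of size `t` implies agreement of all pairs. -/
theorem pairsAgree_of_common_subset {r a : ℝ} (hr : 0 < r) (hr1 : r ≤ 1) (ha0 : 0 ≤ a)
    (hWt : W.card + d ≤ t) (hrk : r * k ≤ (t : ℝ) - (W.card + d) + 1) (htk : t ≤ k) {m : ℕ}
    (hm : k ≤ (m + 1) * (k - t))
    (ha : ∀ T S₁ S₂, W ⊆ T → T ⊆ S₁ → T ⊆ S₂ → T.card = t → S₁.card = k → S₂.card = k →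
      𝔼 π ∈ fixers W, ind (Disagree d g (moved π S₁) (moved π S₂) (moved π T)) ≤ a) :
    PairsAgree d k g W ((m + 1) * (a / r ^ d)) := by
  intro S₁ S₂ h1 h2 c1 c2
  refine expect_disagree_le_of_card_sdiff_le (by positivity) htk ?_ m S₁ S₂ h1 h2 c1 c2 ?_
  · intro S₁ S₂ h1 h2 c1 c2 ht
    rw [le_div_iff₀ (by positivity), mul_comm]
    exact pow_mul_expect_disagree_le hr.le hr1 hWt hrk ha h1 h2 c1 c2 ht
  · exact (card_le_card sdiff_subset).trans (c1.le.trans hm)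

/-- The probability that two random `k`-sets containing `T` disagree on `T`. -/
noncomputable def pairDefect (d k : ℕ) (g : Finset V → Finset V → σ) (T : Finset V) : ℝ :=
  𝔼 S₁ ∈ supersets T k, 𝔼 S₂ ∈ supersets T k, ind (Disagree d g S₁ S₂ T)

theorem pairDefect_nonneg (T : Finset V) : 0 ≤ pairDefect d k g T :=
  expect_nonneg fun _ _ => expect_nonneg fun _ _ => ind_nonneg _

theorem expect_ind_le_one {ι : Type*} (s : Finset ι) {φ : ι → ℝ} (h : ∀ i, φ i ≤ 1) :
    𝔼 i ∈ s, φ i ≤ 1 := by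
  rcases s.eq_empty_or_nonempty with rfl | hs
  · simp
  · exact expect_le hs fun i _ => h i

theorem pairDefect_le_one (T : Finset V) : pairDefect d k g T ≤ 1 :=
  expect_ind_le_one _ fun _ => expect_ind_le_one _ fun _ => ind_le_one _

/-- If all pairs agree, then so do pairs of independent random sets containing a random set. -/
theorem PairsAgree.expect_pairDefect_le {b : ℝ} (h : PairsAgree d k g W b) {s : ℕ}
    (hWs : W.card ≤ s) (hsk : s ≤ k) (hk : k ≤ Fintype.card V) :
    𝔼 U ∈ supersets W s, pairDefect d k g U ≤ b := by
  obtain ⟨U, hU⟩ := supersets_nonempty hWs (hsk.trans hk)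
  rw [mem_supersets] at hU
  have hne : (supersets U k).Nonempty := supersets_nonempty (hU.1.le.trans hsk) hk
  have e := expect_fixers_single hU.2 fun U => pairDefect d k g U
  rw [hU.1] at e
  rw [← e]
  have hinv : ∀ π ∈ fixers W, pairDefect d k g (moved π U) = 𝔼 S₁ ∈ supersets U k,
      𝔼 S₂ ∈ supersets U k, ind (Disagree d g (moved π S₁) (moved π S₂) (moved π U)) := by
    intro π _
    rw [pairDefect, ← expect_supersets_moved π U k fun S₁ => 𝔼 S₂ ∈ supersets (moved π U) k,
      ind (Disagree d g S₁ S₂ (moved π U))]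
    refine expect_congr rfl fun S₁ _ => ?_
    rw [← expect_supersets_moved π U k fun S₂ => ind (Disagree d g (moved π S₁) S₂ (moved π U))]
  rw [expect_congr rfl hinv, expect_comm]
  refine expect_le hne fun S₁ hS₁ => ?_
  rw [expect_comm]
  refine expect_le hne fun S₂ hS₂ => ?_
  rw [mem_supersets] at hS₁ hS₂
  refine le_trans (expect_le_expect fun π _ => ind_mono fun hD => hD.mono ?_)
    (h S₁ S₂ (hU.2.trans hS₁.2) (hU.2.trans hS₂.2) hS₁.1 hS₂.1)
  rw [moved_subset_moved]
  exact subset_inter hS₁.2 hS₂.2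

theorem exists_expect_le_expect_expect {ι : Type*} {s : Finset ι} (hs : s.Nonempty)
    (φ : ι → ι → ℝ) : ∃ y ∈ s, 𝔼 x ∈ s, φ x y ≤ 𝔼 x ∈ s, 𝔼 y ∈ s, φ x y := by
  rw [expect_comm]
  exact exists_le_of_expect_le hs le_rfl

/-- The defects of random `t`-sets control all pairs. -/
theorem pairsAgree_expect_pairDefect (hk : k ≤ Fintype.card V) (hkd : 8 * d ≤ k) {t : ℕ}
    (ht : t = k / 2) (hW : W.card ≤ d) (hk0 : 0 < k) :
    PairsAgree d k g W (4 * 4 ^ d * 𝔼 T ∈ supersets W t, pairDefect d k g T) := by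
  have htk : t ≤ k := by omega
  set Q : ℝ := 𝔼 T ∈ supersets W t, pairDefect d k g T with hQ
  have hQ0 : 0 ≤ Q := expect_nonneg fun _ _ => pairDefect_nonneg _
  have hc : ∀ T : Finset V, ∃ S, T.card = t → S ∈ supersets T k ∧
      𝔼 S' ∈ supersets T k, ind (Disagree d g S' S T) ≤ pairDefect d k g T := by
    intro T
    by_cases hT : T.card = t
    · obtain ⟨S, hS, hle⟩ := exists_expect_le_expect_expect
        (supersets_nonempty (hT.le.trans htk) hk) fun S' S => ind (Disagree d g S' S T)
      exact ⟨S, fun _ => ⟨hS, hle⟩⟩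
    · exact ⟨∅, fun h => absurd h hT⟩
  choose c hc using hc
  have hflag : ∀ T S, W ⊆ T → T ⊆ S → T.card = t → S.card = k →
      𝔼 π ∈ fixers W, ind (Disagree d g (moved π S) (c (moved π T)) (moved π T)) ≤ Q := by
    intro T S hWT hTS hT hS
    rw [expect_fixers_flag' hWT hTS fun T S => ind (Disagree d g S (c T) T), hT, hS]
    refine expect_le_expect fun T hT => ?_
    rw [mem_supersets] at hT
    exact (hc T hT.1).2
  have htk' : (k : ℝ) ≤ 2 * t + 1 := by exact_mod_cast (by omega : k ≤ 2 * t + 1)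
  have hkd' : 8 * (d : ℝ) ≤ k := by exact_mod_cast hkd
  have hW' : (W.card : ℝ) ≤ d := by exact_mod_cast hW
  have key := pairsAgree_of_common_subset (g := g) (W := W) (d := d) (k := k) (t := t)
    (r := 1 / 4) (a := 2 * Q) (m := 1) (by norm_num) (by norm_num)
    (mul_nonneg zero_le_two hQ0) (by omega)
    (by linarith) htk (by omega) ?_
  · have e : ((1 : ℕ) + 1 : ℝ) * (2 * Q / (1 / 4) ^ d) = 4 * 4 ^ d * Q := by
      rw [one_div, inv_pow, div_inv_eq_mul]
      push_cast
      ring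
    rwa [e] at key
  · intro T S₁ S₂ hWT h1 h2 hT hS₁ hS₂
    have e1 := hflag T S₁ hWT h1 hT hS₁
    have e2 := hflag T S₂ hWT h2 hT hS₂
    rw [two_mul]
    refine le_trans ?_ (add_le_add e1 e2)
    rw [← expect_add_distrib]
    exact expect_le_expect fun π _ => ind_le_add fun hD =>
      (hD.or (c (moved π T))).imp id Disagree.symm

end Agreement

section Errors

variable {V : Type*} [Fintype V] [DecidableEq V] {σ : Type*}

open Classical in
/-- The small subsets of `S` at which the local function at `S` differs from `F`. -/
noncomputable def errorFamily (d : ℕ) (g : Finset V → Finset V → σ) (F : Finset V → σ)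
    (S : Finset V) : Finset (Finset V) :=
  S.powerset.filter fun A => A.card ≤ d ∧ g S A ≠ F A

variable {d k t : ℕ} {g : Finset V → Finset V → σ} {F : Finset V → σ} {W : Finset V}

theorem mem_errorFamily {S A : Finset V} :
    A ∈ errorFamily d g F S ↔ A ⊆ S ∧ A.card ≤ d ∧ g S A ≠ F A := by
  simp [errorFamily]

theorem disagree_of_errorFamily_ne {S₁ S₂ U : Finset V} (h1 : U ⊆ S₁) (h2 : U ⊆ S₂)
    (h : (errorFamily d g F S₁).filter (· ⊆ U) ≠ (errorFamily d g F S₂).filter (· ⊆ U)) :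
    Disagree d g S₁ S₂ U := by
  by_contra hD
  refine h ?_
  ext A
  simp only [mem_filter, mem_errorFamily]
  have : A ⊆ U → A.card ≤ d → g S₁ A = g S₂ A := by
    intro hA hd
    by_contra hne
    exact hD ⟨A, hA, hd, hne⟩
  constructor
  · rintro ⟨⟨-, hd, hne⟩, hAU⟩
    exact ⟨⟨hAU.trans h2, hd, this hAU hd ▸ hne⟩, hAU⟩
  · rintro ⟨⟨-, hd, hne⟩, hAU⟩
    exact ⟨⟨hAU.trans h1, hd, (this hAU hd).symm ▸ hne⟩, hAU⟩

theorem supersets_card_self (A : Finset V) : supersets A A.card = {A} := by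
  ext U
  rw [mem_supersets, mem_singleton]
  constructor
  · rintro ⟨h1, h2⟩
    exact (eq_of_subset_of_card_le h2 h1.le).symm
  · rintro rfl
    exact ⟨rfl, Subset.refl _⟩

/-- The value of `F` at `A` is a most popular one, up to the defect of `A`. -/
def IsPopular (d k : ℕ) (g : Finset V → Finset V → σ) (F : Finset V → σ) : Prop :=
  ∀ A : Finset V, A.card ≤ d →
    𝔼 S ∈ supersets A k, ind (g S A ≠ F A) ≤ pairDefect d k g A

theorem IsPopular.expect_mem_errorFamily_le (hF : IsPopular d k g F) {A : Finset V}
    (hA : A.card ≤ d) :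
    𝔼 S ∈ supersets A k, ind (A ∈ errorFamily d g F S) ≤ pairDefect d k g A :=
  le_trans (expect_le_expect fun _ _ => ind_mono fun h => (mem_errorFamily.1 h).2.2) (hF A hA)

/-- The families of errors at `k`-sets extend to a consistent system. -/
theorem exists_isConsistent (hk : k ≤ Fintype.card V) (hkd : 8 * d ≤ k) (hk0 : 0 < k)
    (hF : IsPopular d k g F) :
    ∃ M : Finset V → Finset (Finset V), (∀ S, S.card = k → M S = errorFamily d g F S) ∧
      IsConsistent d k (k / 2) (8 * 4 ^ d) M (pairDefect d k g) := by
  obtain ⟨t, ht⟩ : ∃ t, t = k / 2 := ⟨_, rfl⟩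
  rw [← ht]
  have hc : ∀ U : Finset V, ∃ S, U.card ≤ k → S ∈ supersets U k ∧
      𝔼 S' ∈ supersets U k, ind ((errorFamily d g F S).filter (· ⊆ U) ≠
        (errorFamily d g F S').filter (· ⊆ U)) ≤ pairDefect d k g U := by
    intro U
    by_cases hU : U.card ≤ k
    · obtain ⟨S, hS, hle⟩ := exists_expect_le_expect_expect (supersets_nonempty hU hk)
        fun S' S => ind ((errorFamily d g F S).filter (· ⊆ U) ≠
          (errorFamily d g F S').filter (· ⊆ U))
      refine ⟨S, fun _ => ⟨hS, hle.trans ?_⟩⟩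
      refine expect_le_expect fun S₁ hS₁ => expect_le_expect fun S₂ hS₂ => ind_mono fun h => ?_
      rw [mem_supersets] at hS₁ hS₂
      exact (disagree_of_errorFamily_ne hS₂.2 hS₁.2 h).symm
    · exact ⟨∅, fun h => absurd h hU⟩
  choose c hc using hc
  let M : Finset V → Finset (Finset V) := fun U => (errorFamily d g F (c U)).filter (· ⊆ U)
  have hMk : ∀ S : Finset V, S.card = k → M S = errorFamily d g F S := by
    intro S hS
    have h1 := (hc S hS.le).1
    rw [← hS, supersets_card_self, mem_singleton] at h1
    simp only [M]
    rw [h1, filter_true_of_mem fun A hA => (mem_errorFamily.1 hA).1]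
  have hpairs : ∀ W : Finset V, W.card ≤ d → PairsAgree d k g W
      (4 * 4 ^ d * 𝔼 T ∈ supersets W t, pairDefect d k g T) := fun W hW =>
    pairsAgree_expect_pairDefect hk hkd ht hW hk0
  have hclose : ∀ W U S : Finset V, W.card ≤ d → W ⊆ U → U ⊆ S → S.card = k →
      𝔼 π ∈ fixers W, ind (M (moved π U) ≠
        (errorFamily d g F (moved π S)).filter (· ⊆ moved π U)) ≤
      4 * 4 ^ d * 𝔼 T ∈ supersets W t, pairDefect d k g T := by
    intro W U S hW hWU hUS hS
    rw [expect_fixers_flag' hWU hUS fun U S => ind (M U ≠ (errorFamily d g F S).filter (· ⊆ U)),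
      hS]
    have hUk : U.card ≤ k := hS ▸ card_le_card hUS
    refine le_trans (expect_le_expect fun U' hU' => ?_)
      ((hpairs W hW).expect_pairDefect_le (card_le_card hWU) hUk hk)
    rw [mem_supersets] at hU'
    exact (hc U' (hU'.1.le.trans hUk)).2
  have htk' : (k : ℝ) ≤ 2 * t + 1 := by exact_mod_cast (by omega : k ≤ 2 * t + 1)
  have hkd' : 8 * (d : ℝ) ≤ k := by exact_mod_cast hkd
  refine ⟨M, hMk, ?_, pairDefect_nonneg, pairDefect_le_one, by omega, by omega, hk, ?_, ?_, ?_⟩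
  · intro U A hA
    have := mem_filter.1 hA
    exact ⟨this.2, (mem_errorFamily.1 this.1).2.1⟩
  · linarith
  · intro W u s hWd hWu hus hsk
    obtain ⟨U', hU'⟩ := supersets_nonempty hWu ((hus.trans hsk).trans hk)
    rw [mem_supersets] at hU'
    obtain ⟨U, hU⟩ := supersets_nonempty (hU'.1.le.trans hus) (hsk.trans hk)
    rw [mem_supersets] at hU
    obtain ⟨S, hS⟩ := supersets_nonempty (hU.1.le.trans hsk) hk
    rw [mem_supersets] at hS
    have e := expect_fixers_flag hU'.2 hU.2 fun U' U => ind (M U' ≠ (M U).filter (· ⊆ U'))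
    rw [hU'.1, hU.1] at e
    rw [← e]
    have e1 := hclose W U' S hWd hU'.2 (hU.2.trans hS.2) hS.1
    have e2 := hclose W U S hWd (hU'.2.trans hU.2) hS.2 hS.1
    have e3 : 8 * 4 ^ d * 𝔼 T ∈ supersets W t, pairDefect d k g T =
        4 * 4 ^ d * (𝔼 T ∈ supersets W t, pairDefect d k g T) +
        4 * 4 ^ d * 𝔼 T ∈ supersets W t, pairDefect d k g T := by ring
    rw [e3]
    refine le_trans ?_ (add_le_add e1 e2)
    rw [← expect_add_distrib]
    refine expect_le_expect fun π _ => ind_le_add fun hne => ?_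
    by_contra hcon
    push Not at hcon
    refine hne ?_
    rw [hcon.1, hcon.2, filter_filter]
    refine filter_congr fun A _ => ?_
    have hsub : moved π U' ⊆ moved π U := moved_subset_moved.2 hU.2
    exact ⟨fun h => ⟨h.trans hsub, h⟩, fun h => h.2⟩
  · intro A s hAd hAs hsk
    obtain ⟨U, hU⟩ := supersets_nonempty hAs (hsk.trans hk)
    rw [mem_supersets] at hU
    obtain ⟨S, hS⟩ := supersets_nonempty (hU.1.le.trans hsk) hk
    rw [mem_supersets] at hS
    have e := expect_fixers_single hU.2 fun U => ind (A ∈ M U)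
    rw [hU.1] at e
    rw [← e]
    have e1 := hclose A U S hAd hU.2 hS.2 hS.1
    have e2 := expect_fixers_single (hU.2.trans hS.2) fun S => ind (A ∈ errorFamily d g F S)
    rw [hS.1] at e2
    have e4 := (hpairs A hAd).expect_pairDefect_le le_rfl (hAs.trans hsk) hk
    rw [supersets_card_self, expect_singleton] at e4
    have e5 := e2.le.trans ((hF.expect_mem_errorFamily_le hAd).trans e4)
    have e3 : 8 * 4 ^ d * 𝔼 T ∈ supersets A t, pairDefect d k g T =
        4 * 4 ^ d * (𝔼 T ∈ supersets A t, pairDefect d k g T) +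
        4 * 4 ^ d * 𝔼 T ∈ supersets A t, pairDefect d k g T := by ring
    rw [e3]
    refine le_trans ?_ (add_le_add e1 e5)
    rw [← expect_add_distrib]
    refine expect_le_expect fun π _ => ind_le_add fun hmem => ?_
    by_contra hcon
    push Not at hcon
    rw [hcon.1] at hmem
    exact hcon.2 (mem_filter.1 hmem).1

end Errors

/-- If all pairs agree, then the popular values agree with most local functions. -/
theorem exists_expect_errorFamily_nonempty_le (d : ℕ) :
    ∃ K : ℝ, 0 < K ∧ ∀ (n k : ℕ) {σ : Type*} (g : Finset (Fin n) → Finset (Fin n) → σ)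
      (F : Finset (Fin n) → σ) (b : ℝ), d ≤ k → 0 < k → k ≤ n → IsPopular d k g F →
      PairsAgree d k g ∅ b →
      𝔼 S ∈ supersets ∅ k, ind (errorFamily d g F S).Nonempty ≤ K * b := by
  obtain ⟨K, hK, hmain⟩ := IsConsistent.exists_expect_nonempty_le d
    (show (0 : ℝ) ≤ 8 * 4 ^ d by positivity) d
  refine ⟨K + (d + 1) * 2 ^ (8 * d), by positivity, ?_⟩
  intro n k σ g F b hdk hk0 hkn hF hb
  have hkn' : k ≤ Fintype.card (Fin n) := by simpa using hkn
  have hav : ∀ j ≤ k, 𝔼 A ∈ supersets (∅ : Finset (Fin n)) j, pairDefect d k g A ≤ b :=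
    fun j hj => hb.expect_pairDefect_le (by simp) hj hkn'
  have hb0 : 0 ≤ b :=
    (expect_nonneg fun _ _ => pairDefect_nonneg _).trans (hav 0 (Nat.zero_le k))
  have hpos : (0 : ℝ) ≤ (d + 1) * 2 ^ (8 * d) := by positivity
  by_cases hkd : 8 * d ≤ k
  · obtain ⟨M, hMk, hM⟩ := exists_isConsistent hkn' hkd hk0 hF
    have h1 := hmain n k (k / 2) M _ hM ∅ k (by simp) (by simp) (by simp) le_rfl
    have h2 := hav (k / 2) (by omega)
    calc 𝔼 S ∈ supersets ∅ k, ind (errorFamily d g F S).Nonempty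
        ≤ 𝔼 S ∈ supersets ∅ k, ind (∃ A ∈ M S, ∅ ⊆ A) := by
          refine expect_le_expect fun S hS => ind_mono ?_
          rintro ⟨A, hA⟩
          exact ⟨A, (hMk S (mem_supersets.1 hS).1).symm ▸ hA, empty_subset A⟩
      _ ≤ K * b := h1.trans (by gcongr)
      _ ≤ _ := by nlinarith
  · have h1 := expect_exists_mem_le (M := errorFamily d g F) (d := d) (W := ∅)
      (fun U A hA => ⟨(mem_errorFamily.1 hA).1, (mem_errorFamily.1 hA).2.1⟩) hkn'
      (show k ≤ 8 * d by omega) hb0 (fun j _ hjk hjd => ?_)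
    · calc 𝔼 S ∈ supersets ∅ k, ind (errorFamily d g F S).Nonempty
          ≤ 𝔼 S ∈ supersets ∅ k, ind (∃ A ∈ errorFamily d g F S, ∅ ⊆ A) := by
            refine expect_le_expect fun S _ => ind_mono ?_
            rintro ⟨A, hA⟩
            exact ⟨A, hA, empty_subset A⟩
        _ ≤ (d + 1) * 2 ^ (8 * d) * b := h1
        _ ≤ _ := by nlinarith
    · refine le_trans (expect_le_expect fun A hA => ?_) (hav j hjk)
      exact hF.expect_mem_errorFamily_le ((mem_supersets.1 hA).1.le.trans hjd)

theorem uniformProb_eq_expect {Ω : Type*} (s : Finset Ω) (P : Ω → Prop) :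
    uniformProb s P = 𝔼 i ∈ s, ind (P i) := by
  classical
  rw [uniformProb, expect_eq_sum_div_card, sum_ind_eq_card_filter]

/-- A local ensemble as a function on all pairs of sets. -/
def LocalEnsemble.total {n k d : ℕ} {Alphabet : Type*} (f : LocalEnsemble n k d Alphabet)
    (S A : Finset (Fin n)) : Option Alphabet :=
  if h : S.card = k ∧ A ⊆ S ∧ A.card ≤ d then some (f ⟨S, h.1⟩ ⟨A, h.2⟩) else none

theorem LocalEnsemble.total_eq {n k d : ℕ} {Alphabet : Type*} (f : LocalEnsemble n k d Alphabet)
    (S : KSubset n k) (A : SmallSubset d S.1) : f.total S.1 A.1 = some (f S A) := by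
  rw [LocalEnsemble.total, dif_pos ⟨S.2, A.2⟩]

theorem restrictTo_ne_iff_disagree {n k d : ℕ} {Alphabet : Type*}
    (f : LocalEnsemble n k d Alphabet) (S₁ S₂ : KSubset n k) :
    restrictTo (inter_subset_left : S₁.1 ∩ S₂.1 ⊆ S₁.1) (f S₁) ≠
      restrictTo (inter_subset_right : S₁.1 ∩ S₂.1 ⊆ S₂.1) (f S₂) ↔
    Disagree d f.total S₁.1 S₂.1 (S₁.1 ∩ S₂.1) := by
  rw [Function.ne_iff]
  constructor
  · rintro ⟨A, hA⟩
    refine ⟨A.1, A.2.1, A.2.2, fun h => hA ?_⟩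
    have e1 := f.total_eq S₁ ⟨A.1, A.2.1.trans inter_subset_left, A.2.2⟩
    have e2 := f.total_eq S₂ ⟨A.1, A.2.1.trans inter_subset_right, A.2.2⟩
    rw [e1, e2] at h
    exact Option.some.inj h
  · rintro ⟨A, hA, hd, hne⟩
    refine ⟨⟨A, hA, hd⟩, fun h => hne ?_⟩
    have e1 := f.total_eq S₁ ⟨A, hA.trans inter_subset_left, hd⟩
    have e2 := f.total_eq S₂ ⟨A, hA.trans inter_subset_right, hd⟩
    rw [e1, e2]
    exact congrArg some h

theorem disagreementProb_eq_expect {n k d t : ℕ} {Alphabet : Type*}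
    (f : LocalEnsemble n k d Alphabet) {S₁ S₂ : Finset (Fin n)} (h1 : S₁.card = k)
    (h2 : S₂.card = k) (h : (S₁ ∩ S₂).card = t) :
    𝔼 π ∈ fixers (∅ : Finset (Fin n)),
        ind (Disagree d f.total (moved π S₁) (moved π S₂) (moved π (S₁ ∩ S₂))) =
      disagreementProb t f := by
  rw [disagreementProb, uniformProb_eq_expect]
  simp only [restrictTo_ne_iff_disagree, moved_inter]
  let φ : Finset (Fin n) → Finset (Fin n) → ℝ := fun A B => ind (Disagree d f.total A B (A ∩ B))
  have hne : (pairsWithInter n k t).Nonempty := by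
    refine ⟨(⟨S₁, h1⟩, ⟨S₂, h2⟩), ?_⟩
    simpa [pairsWithInter] using h
  have hinv : ∀ π ∈ fixers (∅ : Finset (Fin n)), 𝔼 p ∈ pairsWithInter n k t,
      φ (moved π p.1.1) (moved π p.2.1) = 𝔼 p ∈ pairsWithInter n k t, φ p.1.1 p.2.1 := by
    intro π _
    let m : KSubset n k → KSubset n k := fun S => ⟨moved π S.1, (card_moved π S.1).trans S.2⟩
    have hm : Function.Bijective m := by
      refine Finite.injective_iff_bijective.1 fun S S' hS => Subtype.ext ?_
      exact (moved_bijective π).1 (congrArg Subtype.val hS)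
    refine expect_equiv (Equiv.prodCongr (Equiv.ofBijective m hm) (Equiv.ofBijective m hm))
      (fun p => ?_) fun p _ => rfl
    simp only [pairsWithInter, mem_filter, mem_univ, true_and, Equiv.prodCongr_apply, Prod.map,
      Equiv.ofBijective_apply, m]
    rw [← moved_inter, card_moved]
  calc 𝔼 π ∈ fixers (∅ : Finset (Fin n)), φ (moved π S₁) (moved π S₂)
      = 𝔼 p ∈ pairsWithInter n k t, 𝔼 π ∈ fixers (∅ : Finset (Fin n)),
          φ (moved π S₁) (moved π S₂) := (expect_const hne _).symm
    _ = 𝔼 p ∈ pairsWithInter n k t, 𝔼 π ∈ fixers (∅ : Finset (Fin n)),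
          φ (moved π p.1.1) (moved π p.2.1) := by
        refine expect_congr rfl fun p hp => ?_
        simp only [pairsWithInter, mem_filter, mem_univ, true_and] at hp
        exact expect_fixers_pair_eq (empty_subset _) (empty_subset _) (empty_subset _)
          (empty_subset _) (h1.trans p.1.2.symm) (h2.trans p.2.2.symm) (h.trans hp.symm) φ
    _ = 𝔼 π ∈ fixers (∅ : Finset (Fin n)), 𝔼 p ∈ pairsWithInter n k t, φ p.1.1 p.2.1 := by
        rw [expect_comm]; exact expect_congr rfl hinv
    _ = 𝔼 p ∈ pairsWithInter n k t, φ p.1.1 p.2.1 := expect_const (fixers_nonempty _) _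

theorem disagreementProb_nonneg {n k d t : ℕ} {Alphabet : Type*}
    (f : LocalEnsemble n k d Alphabet) : 0 ≤ disagreementProb t f := by
  rw [disagreementProb, uniformProb]
  positivity

/-- Two sets with a common subset `T` of size `t` can be compared on `T` through a third set that
meets both of them exactly in `T`. -/
theorem expect_disagree_le_two_mul_disagreementProb {n k d t : ℕ} {Alphabet : Type*}
    (f : LocalEnsemble n k d Alphabet) (hn : 3 * k ≤ n) {T S₁ S₂ : Finset (Fin n)}
    (hT1 : T ⊆ S₁) (hT2 : T ⊆ S₂) (hT : T.card = t) (h1 : S₁.card = k) (h2 : S₂.card = k) :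
    𝔼 π ∈ fixers (∅ : Finset (Fin n)),
        ind (Disagree d f.total (moved π S₁) (moved π S₂) (moved π T)) ≤
      2 * disagreementProb t f := by
  have htk : t ≤ k := by rw [← hT, ← h1]; exact card_le_card hT1
  have hcompl : k - t ≤ ((S₁ ∪ S₂)ᶜ).card := by
    rw [card_compl, Fintype.card_fin]
    have := card_union_le S₁ S₂
    omega
  obtain ⟨R, hR, hRc⟩ := exists_subset_card_eq hcompl
  have hR' : ∀ x ∈ R, x ∉ S₁ ∧ x ∉ S₂ := fun x hx => by
    have := hR hx
    simpa using this
  have hTR : Disjoint T R := disjoint_left.2 fun x hx hxR => (hR' x hxR).1 (hT1 hx)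
  have hc : (T ∪ R).card = k := by rw [card_union_of_disjoint hTR]; omega
  have i1 : S₁ ∩ (T ∪ R) = T := by
    ext x
    simp only [mem_inter, mem_union]
    constructor
    · rintro ⟨hx, hx' | hx'⟩
      · exact hx'
      · exact absurd hx (hR' x hx').1
    · exact fun hx => ⟨hT1 hx, Or.inl hx⟩
  have i2 : S₂ ∩ (T ∪ R) = T := by
    ext x
    simp only [mem_inter, mem_union]
    constructor
    · rintro ⟨hx, hx' | hx'⟩
      · exact hx'
      · exact absurd hx (hR' x hx').2
    · exact fun hx => ⟨hT2 hx, Or.inl hx⟩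
  have e1 := disagreementProb_eq_expect f h1 hc (t := t) (by rw [i1, hT])
  have e2 := disagreementProb_eq_expect f h2 hc (t := t) (by rw [i2, hT])
  rw [i1] at e1
  rw [i2] at e2
  rw [two_mul]
  nth_rw 1 [← e1]
  rw [← e2, ← expect_add_distrib]
  exact expect_le_expect fun π _ => ind_le_add fun hD =>
    (hD.or (moved π (T ∪ R))).imp id Disagree.symm

/-- A global function of popular values. -/
theorem exists_isPopular {n k d : ℕ} {Alphabet : Type*} (f : LocalEnsemble n k d Alphabet)
    (hdk : d ≤ k) (hkn : k ≤ n) :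
    ∃ (F : GlobalFunction n d Alphabet) (F' : Finset (Fin n) → Option Alphabet),
      (∀ A, F' A.1 = some (F A)) ∧ IsPopular d k f.total F' := by
  have hkn' : k ≤ Fintype.card (Fin n) := by simpa using hkn
  have hc : ∀ A : Finset (Fin n), ∃ S, A.card ≤ d → S ∈ supersets A k ∧
      𝔼 S' ∈ supersets A k, ind (f.total S' A ≠ f.total S A) ≤ pairDefect d k f.total A := by
    intro A
    by_cases hA : A.card ≤ d
    · obtain ⟨S, hS, hle⟩ := exists_expect_le_expect_expect
        (supersets_nonempty (hA.trans hdk) hkn') fun S' S => ind (f.total S' A ≠ f.total S A)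
      refine ⟨S, fun _ => ⟨hS, hle.trans ?_⟩⟩
      exact expect_le_expect fun S₁ _ => expect_le_expect fun S₂ _ => ind_mono fun h =>
        ⟨A, Subset.refl A, hA, h⟩
    · exact ⟨∅, fun h => absurd h hA⟩
  choose c hc using hc
  have hmem := fun (A : Finset (Fin n)) (hA : A.card ≤ d) => mem_supersets.1 (hc A hA).1
  refine ⟨fun A => f ⟨c A.1, (hmem A.1 A.2.2).1⟩ ⟨A.1, (hmem A.1 A.2.2).2, A.2.2⟩,
    fun A => f.total (c A) A, fun A => ?_, fun A hA => (hc A hA).2⟩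
  exact f.total_eq ⟨c A.1, (hmem A.1 A.2.2).1⟩ ⟨A.1, (hmem A.1 A.2.2).2, A.2.2⟩

theorem globalErrorProb_le {n k d : ℕ} {Alphabet : Type*} (f : LocalEnsemble n k d Alphabet)
    (F : GlobalFunction n d Alphabet) (F' : Finset (Fin n) → Option Alphabet)
    (hF : ∀ A, F' A.1 = some (F A)) :
    globalErrorProb f F ≤ 𝔼 S ∈ supersets ∅ k, ind (errorFamily d f.total F' S).Nonempty := by
  rw [globalErrorProb, uniformProb_eq_expect]
  have e : 𝔼 S : KSubset n k, ind (errorFamily d f.total F' S.1).Nonempty =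
      𝔼 S ∈ supersets ∅ k, ind (errorFamily d f.total F' S).Nonempty := by
    refine expect_bij (fun S _ => S.1) (fun S _ => ?_) (fun S _ => rfl)
      (fun S _ S' _ h => Subtype.ext h) fun S hS => ?_
    · exact mem_supersets.2 ⟨S.2, empty_subset _⟩
    · exact ⟨⟨S, (mem_supersets.1 hS).1⟩, mem_univ _, rfl⟩
  rw [← e]
  refine expect_le_expect fun S _ => ind_mono fun hne => ?_
  obtain ⟨A, hA⟩ := Function.ne_iff.1 hne
  refine ⟨A.1, mem_errorFamily.2 ⟨A.2.1, A.2.2, fun h => hA ?_⟩⟩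
  have e2 := hF ⟨A.1, A.2.1.trans (subset_univ _), A.2.2⟩
  rw [f.total_eq S A] at h
  exact Option.some.inj (h.trans e2)

theorem theorem3p1 :
    ∃ C : ℝ, 1 < C ∧
      ∀ (d : ℕ) (α β : ℝ), 0 < d → 0 < α → α < 1 → 0 < β → β < 1 → α + β ≤ 1 →
        ∃ K : ℝ, 0 < K ∧
          ∀ (n k t : ℕ), 0 < n → 0 < k → 0 < t →
            C * (k : ℝ) ≤ (n : ℝ) →
            max (α * (k : ℝ)) (d : ℝ) ≤ (t : ℝ) →
            max (β * (k : ℝ)) (d : ℝ) ≤ (k : ℝ) - (t : ℝ) →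
            ∀ (Alphabet : Type*) (f : LocalEnsemble n k d Alphabet) (ε : ℝ),
              disagreementProb t f ≤ ε →
                ∃ F : GlobalFunction n d Alphabet, globalErrorProb f F ≤ K * ε := by
  refine ⟨3, by norm_num, fun d α β hd hα hα1 hβ _ _ => ?_⟩
  obtain ⟨K, hK, hmain⟩ := exists_expect_errorFamily_nonempty_le d
  obtain ⟨m, hm⟩ := exists_nat_ge (1 / β)
  have hd1 : (1 : ℝ) ≤ d := by exact_mod_cast hd
  have hr : 0 < α / d := by positivity
  refine ⟨K * ((m + 1) * (2 / (α / d) ^ d)), by positivity, ?_⟩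
  intro n k t _ hk _ hn hmax ht Alphabet f ε hε
  obtain ⟨hαt, hdt⟩ := max_le_iff.1 hmax
  obtain ⟨hβt, hdkt⟩ := max_le_iff.1 ht
  have hn' : 3 * k ≤ n := by exact_mod_cast hn
  have hdt' : d ≤ t := by exact_mod_cast hdt
  have htk : t ≤ k := by
    have : (t : ℝ) ≤ k := by linarith
    exact_mod_cast this
  have hε0 : 0 ≤ disagreementProb t f := disagreementProb_nonneg f
  have hchain : k ≤ (m + 1) * (k - t) := by
    have h1 : 1 ≤ m * β := by rwa [div_le_iff₀ hβ] at hm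
    have h2 : (0 : ℝ) ≤ (k : ℝ) - t := by linarith
    have h3 : (k : ℝ) ≤ (m + 1) * ((k : ℝ) - t) := by
      have hk0 : (0 : ℝ) ≤ k := Nat.cast_nonneg k
      have hm0 : (0 : ℝ) ≤ m := Nat.cast_nonneg m
      nlinarith
    rw [← Nat.cast_sub htk] at h3
    exact_mod_cast h3
  have hrk : α / d * k ≤ (t : ℝ) - (((∅ : Finset (Fin n)).card : ℕ) + d) + 1 := by
    rw [card_empty, Nat.cast_zero, zero_add, div_mul_eq_mul_div, div_le_iff₀ (by linarith)]
    nlinarith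
  have hpairs := pairsAgree_of_common_subset (g := f.total) (W := ∅) (d := d) (k := k) (t := t)
    (m := m) hr ((div_le_one (by linarith)).2 (by linarith)) (mul_nonneg zero_le_two hε0)
    (by simpa using hdt') hrk htk hchain fun T S₁ S₂ _ hT1 hT2 hT h1 h2 =>
      expect_disagree_le_two_mul_disagreementProb f hn' hT1 hT2 hT h1 h2
  obtain ⟨F, F', hFF', hF'⟩ := exists_isPopular f (hdt'.trans htk) (by omega)
  refine ⟨F, (globalErrorProb_le f F F' hFF').trans ?_⟩
  refine (hmain n k f.total F' _ (hdt'.trans htk) hk (by omega) hF' hpairs).trans ?_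
  calc K * ((m + 1) * (2 * disagreementProb t f / (α / d) ^ d))
      = K * ((m + 1) * (2 / (α / d) ^ d)) * disagreementProb t f := by ring
    _ ≤ _ := by gcongr
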